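/- There is a universal constant $C\in(0,\infty)$ such that the following holds for all $\varepsilon,\delta\in(0,1)$, $n\in\mathbb{N}$, $d\in\{1,\ldots,n\}$ and $N\in\mathbb{N}$ with $$N\ \geq\ \min\left\{\frac{\exp\big(Cd^{3/2}\sqrt{\log \max\{d,2\}}\big)}{\varepsilon^{d+1}},\ \frac{4dn^{d}}{\varepsilon}\right\}\log\left(\frac{n}{\delta}\right).$$ There is a randomized procedure, depending only on $n,d,\varepsilon,\delta,N$, which from $N$ labelled examples $(X_1,f(X_1)),\ldots,(X_N,f(X_N))$ of an unknown function $f$ and from finitely many additional independent fair coin flips produces a function $h:\{-1,1\}^n\to\mathbb{R}$, such that for every $f:\{-1,1\}^n\to[-1,1]$ of degree at most $d$, if $X_1,\ldots,X_N$ are independent and uniformly distributed on $\{-1,1\}^n$ (and independent of the coins), then $$\|h-f\|_{L_2}^2<\varepsilon\quad\text{with probability at least } 1-\delta .$$ When $n\geq 2$ no coin flips are needed, that is, $h$ can be taken to be a deterministic function of the examples. Here $f$ has degree at most $d$ if $\hat f(S)=2^{-n}\sum_{y\in\{-1,1\}^n} f(y)\prod_{i\in S}y_i$ vanishes for every $S\subseteq\{1,\ldots,n\}$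 with $|S|>d$, and $\|g\|_{L_2}^2=2^{-n}\sum_{x\in\{-1,1\}^n} g(x)^2$. -/

import Mathlib

open MeasureTheory ProbabilityTheory

noncomputable section

/-- The discrete hypercube `{-1, 1}^n`; the units of `ℤ` are exactly `1` and `-1`. -/
abbrev Cube (n : ℕ) : Type := Fin n → ℤˣ

/-- `ℤˣ = {-1, 1}` carries the discrete measurable structure. -/
instance instSingletonClassIntUnits : MeasurableSingletonClass ℤˣ where
  measurableSet_singleton u :=
    ⟨{(u : ℤ)}, measurableSet_singleton _, by ext v; simp [Units.ext_iff]⟩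

/-- The Walsh function `w_S(x) = ∏_{i ∈ S} x_i`. -/
def walsh {n : ℕ} (S : Finset (Fin n)) (x : Cube n) : ℝ :=
  ∏ i ∈ S, ((x i : ℤ) : ℝ)

/-- The Fourier–Walsh coefficient `2^{-n} ∑_y f(y) w_S(y)`. -/
def walshCoeff {n : ℕ} (f : Cube n → ℝ) (S : Finset (Fin n)) : ℝ :=
  1 / 2 ^ n * ∑ y : Cube n, f y * walsh S y

/-- `f` has degree at most `d`: its Walsh coefficients vanish on all sets with more than
`d` elements. -/
def DegreeAtMost {n : ℕ} (d : ℕ) (f : Cube n → ℝ) : Prop :=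
  ∀ S : Finset (Fin n), d < S.card → walshCoeff f S = 0

/-- The squared `L₂` norm with respect to the uniform probability measure on the cube. -/
def l2NormSq {n : ℕ} (g : Cube n → ℝ) : ℝ :=
  1 / 2 ^ n * ∑ x : Cube n, g x ^ 2

/-- The uniform probability measure on the cube. -/
def cubeUniform (n : ℕ) : Measure (Cube n) := uniformOn Set.univ

/-- A learner with `N` examples on the `n`-cube and `m` coins: from the outcomes of the coins
and the labelled examples `(x_1, y_1), …, (x_N, y_N)` it produces a hypothesis function. Its
only access to the unknown function is through the examples. For `m = 0` it is a
deterministic function of the examples. -/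
abbrev Learner (n N m : ℕ) : Type :=
  (Fin m → Bool) → (Fin N → Cube n × ℝ) → (Cube n → ℝ)

/-- The joint law of `m` independent fair coins and, independently of them, `N` independent
uniformly random points of the cube. -/
def queryLaw (n N m : ℕ) : Measure ((Fin m → Bool) × (Fin N → Cube n)) :=
  (Measure.pi fun _ : Fin m => (uniformOn Set.univ : Measure Bool)).prod
    (Measure.pi fun _ : Fin N => cubeUniform n)

/-- The random hypothesis produced by a learner when the unknown function is `f`, as a function
of the coins and of the random points. -/
def Learner.hypothesis {n N m : ℕ} (A : Learner n N m) (f : Cube n → ℝ)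
    (ω : (Fin m → Bool) × (Fin N → Cube n)) : Cube n → ℝ :=
  A ω.1 fun j => (ω.2 j, f (ω.2 j))

end

/-!
The learner depends on which term of the minimum is the smaller one.

**First term.** The empirical Walsh coefficients of degree at most `d` are all within `b` of the true
ones by the Chernoff bound and a union bound over at most `n ^ (4 d)` sets. The learner keeps those of
absolute value at least `2 b`. By `l2NormSq_thresholdHypothesis_sub_le` the squared error is at most
`3 b ^ (2/(d+1)) ∑ |a_S| ^ (2d/(d+1))`, so the sample size is governed by the constant in the
Bohnenblust–Hille inequality `sum_sq_rpow_le`, which is `exp (O (√(d log d)))`. Its proof rests on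
three facts.

* `cubeMean_sq_rpow_le`: hypercontractivity, a comparison of the second moment with the moment of
  order `2k/(k+1)`, with constant `9 ^ (d/(k+1))`. It is Bonami's `L₂`–`L₄` inequality, interpolated.
* `sum_card_eq_rpow_le`: Blei's mixed norm inequality. It is proved by entropy: for the Gibbs
  distribution of the array, some `k` of the `m` coordinates carry the fraction `k/m` of the entropy.
* `abs_sum_taylor_le`: at distance `1/(d+1)` from the boundary of `[-1, 1] ^ n` the homogeneous Taylor
  polynomial of order `k` of the multilinear extension is at most `d ^ O(k)`, by Markov's inequality
  for the derivatives of a polynomial at an end point of an interval.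

With `k = 1` they yield a constant exponential in `d`. That version, applied to the Taylor polynomials
of order `k`, is the input for general `k`, and `k ≈ √(d / log d)` balances `9 ^ (d/(k+1))` against
`d ^ O(k)`.

**Second term.** The learner returns any function of degree at most `d` that agrees with the examples.
A nonzero function of degree at most `d` is nonzero on a fraction at least `2 ^ (-d)` of the cube, so
with at least this probability a new example lowers the dimension of the space of such functions
vanishing on the sample. In expectation, `2 ^ (dim - 1)` therefore decays by the factor
`1 - 2 ^ (-d-1)`, and the sample determines the function with probability at least `1 - δ`.

**Dimension one.** Here `log (n / δ)` may be small, so that one example has to be enough; the value at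
the unseen point is then guessed with coins.

All probabilities are computed by counting samples (`queryLaw_real_eq`).
-/

/-! ### Walsh expansions and the multilinear extension -/

/-- The function on the cube with Walsh coefficients `a`. -/
noncomputable def walshSum {n : ℕ} (a : Finset (Fin n) → ℝ) (x : Cube n) : ℝ :=
  ∑ S, a S * walsh S x

/-- The multilinear polynomial with coefficients `a`; it extends `walshSum a` from the cube to
`ℝ^n`. -/
noncomputable def multiExt {n : ℕ} (a : Finset (Fin n) → ℝ) (z : Fin n → ℝ) : ℝ :=
  ∑ S, a S * ∏ i ∈ S, z i

/-- A point of the cube as a real vector. -/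
def cubeVec {n : ℕ} (x : Cube n) (i : Fin n) : ℝ := ((x i : ℤ) : ℝ)

theorem sum_intUnits (F : ℤˣ → ℝ) : ∑ u : ℤˣ, F u = F 1 + F (-1) := by
  rw [show (Finset.univ : Finset ℤˣ) = {1, -1} from rfl, Finset.sum_pair (by decide)]

theorem cubeVec_sq {n : ℕ} (x : Cube n) (i : Fin n) : cubeVec x i ^ 2 = 1 := by
  rcases Int.units_eq_one_or (x i) with h | h <;> simp [cubeVec, h]

theorem abs_cubeVec {n : ℕ} (x : Cube n) (i : Fin n) : |cubeVec x i| = 1 := by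
  rcases Int.units_eq_one_or (x i) with h | h <;> simp [cubeVec, h]

theorem abs_walsh {n : ℕ} (S : Finset (Fin n)) (x : Cube n) : |walsh S x| = 1 := by
  rw [walsh, Finset.abs_prod]
  exact Finset.prod_eq_one fun i _ => abs_cubeVec x i

theorem card_cube (n : ℕ) : Fintype.card (Cube n) = 2 ^ n := by
  simp [Cube, Fintype.card_units_int]

theorem sum_cube_prod {n : ℕ} (F : Fin n → ℤˣ → ℝ) :
    ∑ x : Cube n, ∏ i, F i (x i) = ∏ i, (F i 1 + F i (-1)) := by
  simp_rw [← sum_intUnits]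
  rw [Finset.prod_univ_sum, Fintype.piFinset_univ]

theorem walsh_eq_prod_ite {n : ℕ} (S : Finset (Fin n)) (x : Cube n) :
    walsh S x = ∏ i, if i ∈ S then ((x i : ℤ) : ℝ) else 1 := by
  rw [Finset.prod_ite_mem, Finset.univ_inter, walsh]

/-- Integration against the Poisson-type kernel `∏ (1 + x_i z_i) / 2`, a probability density on
the cube when `z ∈ [-1, 1]^n`, evaluates the multilinear extension at `z`. -/
theorem sum_kernel_mul_walsh {n : ℕ} (z : Fin n → ℝ) (S : Finset (Fin n)) :
    ∑ x : Cube n, (∏ i, (1 + cubeVec x i * z i) / 2) * walsh S x = ∏ i ∈ S, z i := by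
  have h : ∀ x : Cube n, (∏ i, (1 + cubeVec x i * z i) / 2) * walsh S x =
      ∏ i, ((1 + ((x i : ℤ) : ℝ) * z i) / 2 * if i ∈ S then ((x i : ℤ) : ℝ) else 1) := by
    intro x
    rw [walsh_eq_prod_ite, ← Finset.prod_mul_distrib]
    rfl
  rw [Finset.sum_congr rfl fun x _ => h x, sum_cube_prod fun i (u : ℤˣ) =>
    ((1 + ((u : ℤ) : ℝ) * z i) / 2 * if i ∈ S then ((u : ℤ) : ℝ) else 1)]
  rw [← Finset.univ_inter S, ← Finset.prod_ite_mem, Finset.univ_inter]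
  refine Finset.prod_congr rfl fun i _ => ?_
  split_ifs <;> simp <;> ring

theorem abs_multiExt_le {n : ℕ} {a : Finset (Fin n) → ℝ} {M : ℝ}
    (h : ∀ x : Cube n, |walshSum a x| ≤ M) {z : Fin n → ℝ} (hz : ∀ i, |z i| ≤ 1) :
    |multiExt a z| ≤ M := by
  have hk : ∀ x : Cube n, 0 ≤ ∏ i, (1 + cubeVec x i * z i) / 2 := fun x =>
    Finset.prod_nonneg fun i _ => by
      have : |cubeVec x i * z i| ≤ 1 := by rw [abs_mul, abs_cubeVec, one_mul]; exact hz i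
      linarith [(abs_le.1 this).1]
  have h1 : ∑ x : Cube n, ∏ i, (1 + cubeVec x i * z i) / 2 = 1 := by
    simpa [walsh] using sum_kernel_mul_walsh z ∅
  have h2 : multiExt a z = ∑ x : Cube n, (∏ i, (1 + cubeVec x i * z i) / 2) * walshSum a x := by
    simp_rw [walshSum, Finset.mul_sum, multiExt]
    rw [Finset.sum_comm]
    refine Finset.sum_congr rfl fun S _ => ?_
    rw [← sum_kernel_mul_walsh z S, Finset.mul_sum]
    exact Finset.sum_congr rfl fun x _ => by ring
  rw [h2]
  calc _ ≤ ∑ x : Cube n, |(∏ i, (1 + cubeVec x i * z i) / 2) * walshSum a x| :=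
        Finset.abs_sum_le_sum_abs _ _
    _ ≤ ∑ x : Cube n, (∏ i, (1 + cubeVec x i * z i) / 2) * M := Finset.sum_le_sum fun x _ => by
        rw [abs_mul, abs_of_nonneg (hk x)]
        exact mul_le_mul_of_nonneg_left (h x) (hk x)
    _ = M := by rw [← Finset.sum_mul, h1, one_mul]

theorem sum_walsh_mul_walsh {n : ℕ} (S T : Finset (Fin n)) :
    ∑ x : Cube n, walsh S x * walsh T x = if S = T then 2 ^ n else 0 := by
  simp_rw [walsh_eq_prod_ite, ← Finset.prod_mul_distrib]
  rw [sum_cube_prod fun i (u : ℤˣ) => ((if i ∈ S then ((u : ℤ) : ℝ) else 1) *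
    if i ∈ T then ((u : ℤ) : ℝ) else 1)]
  split_ifs with h
  · subst h
    rw [Finset.prod_congr rfl (g := fun _ => (2 : ℝ)) fun i _ => by split_ifs <;> norm_num]
    simp
  · obtain ⟨i, hi⟩ : ∃ i, ¬(i ∈ S ↔ i ∈ T) := by
      by_contra! hc
      exact h (Finset.ext hc)
    refine Finset.prod_eq_zero (Finset.mem_univ i) ?_
    by_cases h1 : i ∈ S <;> by_cases h2 : i ∈ T <;> simp_all

theorem sum_walsh_walsh_eq {n : ℕ} (x y : Cube n) :
    ∑ S : Finset (Fin n), walsh S y * walsh S x = if y = x then 2 ^ n else 0 := by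
  have h : ∀ S : Finset (Fin n), walsh S y * walsh S x = ∏ i ∈ S, cubeVec y i * cubeVec x i :=
    fun S => Finset.prod_mul_distrib.symm
  rw [Finset.sum_congr rfl fun S _ => h S, ← Finset.powerset_univ, ← Finset.prod_one_add]
  split_ifs with hxy
  · subst hxy
    rw [Finset.prod_congr rfl (g := fun _ => (2 : ℝ)) fun i _ => by
      rw [← sq, cubeVec_sq]; norm_num]
    simp
  · obtain ⟨i, hi⟩ := Function.ne_iff.1 hxy
    refine Finset.prod_eq_zero (Finset.mem_univ i) ?_
    rcases Int.units_eq_one_or (x i) with h1 | h1 <;>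
      rcases Int.units_eq_one_or (y i) with h2 | h2 <;> simp_all [cubeVec]

theorem walshSum_walshCoeff {n : ℕ} (f : Cube n → ℝ) : walshSum (walshCoeff f) = f := by
  funext x
  have h : ∀ S, walshCoeff f S * walsh S x =
      ∑ y : Cube n, 1 / 2 ^ n * f y * (walsh S y * walsh S x) := fun S => by
    rw [walshCoeff, Finset.mul_sum, Finset.sum_mul]
    exact Finset.sum_congr rfl fun y _ => by ring
  rw [walshSum, Finset.sum_congr rfl fun S _ => h S, Finset.sum_comm]
  simp_rw [← Finset.mul_sum, sum_walsh_walsh_eq]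
  simp
  field_simp

theorem walshCoeff_walshSum {n : ℕ} (a : Finset (Fin n) → ℝ) : walshCoeff (walshSum a) = a := by
  funext T
  simp_rw [walshCoeff, walshSum, Finset.sum_mul]
  rw [Finset.sum_comm]
  simp_rw [mul_assoc, ← Finset.mul_sum, sum_walsh_mul_walsh]
  simp
  field_simp

theorem l2NormSq_walshSum {n : ℕ} (a : Finset (Fin n) → ℝ) :
    l2NormSq (walshSum a) = ∑ S, a S ^ 2 := by
  have h : ∀ x : Cube n, walshSum a x ^ 2 = ∑ S, a S * (walshSum a x * walsh S x) := fun x => by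
    conv_lhs => rw [sq]; enter [2]; rw [walshSum]
    rw [Finset.mul_sum]
    exact Finset.sum_congr rfl fun y _ => by ring
  rw [l2NormSq, Finset.sum_congr rfl fun x _ => h x, Finset.sum_comm, Finset.mul_sum]
  refine Finset.sum_congr rfl fun S _ => ?_
  have := congrFun (walshCoeff_walshSum a) S
  rw [walshCoeff] at this
  rw [← Finset.mul_sum, mul_left_comm, this, sq]

/-! ### Hypercontractivity -/

/-- The expectation with respect to the uniform measure on the cube. -/
noncomputable def cubeMean {n : ℕ} (g : Cube n → ℝ) : ℝ := 1 / 2 ^ n * ∑ x, g x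

theorem cubeMean_mono {n : ℕ} {g h : Cube n → ℝ} (H : ∀ x, g x ≤ h x) :
    cubeMean g ≤ cubeMean h :=
  mul_le_mul_of_nonneg_left (Finset.sum_le_sum fun x _ => H x) (by positivity)

theorem cubeMean_nonneg {n : ℕ} {g : Cube n → ℝ} (H : ∀ x, 0 ≤ g x) : 0 ≤ cubeMean g :=
  mul_nonneg (by positivity) (Finset.sum_nonneg fun x _ => H x)

theorem cubeMean_const {n : ℕ} (c : ℝ) : cubeMean (fun _ : Cube n => c) = c := by
  simp [cubeMean]

theorem cubeMean_add {n : ℕ} (g h : Cube n → ℝ) :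
    cubeMean (fun x => g x + h x) = cubeMean g + cubeMean h := by
  simp [cubeMean, Finset.sum_add_distrib, mul_add]

theorem cubeMean_const_mul {n : ℕ} (c : ℝ) (g : Cube n → ℝ) :
    cubeMean (fun x => c * g x) = c * cubeMean g := by
  simp only [cubeMean, ← Finset.mul_sum]
  ring

theorem cubeMean_sum {n : ℕ} {ι : Type*} (s : Finset ι) (g : ι → Cube n → ℝ) :
    cubeMean (fun x => ∑ i ∈ s, g i x) = ∑ i ∈ s, cubeMean (g i) := by
  simp only [cubeMean]
  rw [Finset.sum_comm, Finset.mul_sum]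

theorem cubeMean_mul_sq_le {n : ℕ} (g h : Cube n → ℝ) :
    cubeMean (fun x => g x * h x) ^ 2 ≤ cubeMean (fun x => g x ^ 2) * cubeMean fun x => h x ^ 2 := by
  have := Finset.sum_mul_sq_le_sq_mul_sq Finset.univ g h
  have h2 : (0 : ℝ) ≤ (1 / 2 ^ n) ^ 2 := by positivity
  simp only [cubeMean]
  nlinarith [mul_le_mul_of_nonneg_left this h2]

/-- Flipping the `i`-th sign. -/
def flipCoord {n : ℕ} (i : Fin n) (x : Cube n) : Cube n := Function.update x i (-x i)

theorem flipCoord_involutive {n : ℕ} (i : Fin n) : Function.Involutive (flipCoord i) := fun x => by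
  simp [flipCoord]

theorem cubeMean_flipCoord {n : ℕ} (i : Fin n) (g : Cube n → ℝ) :
    cubeMean (fun x => g (flipCoord i x)) = cubeMean g := by
  simp only [cubeMean]
  congr 1
  exact Equiv.sum_comp (flipCoord_involutive i).toPerm g

theorem walsh_flipCoord_of_notMem {n : ℕ} {i : Fin n} {S : Finset (Fin n)} (hi : i ∉ S)
    (x : Cube n) : walsh S (flipCoord i x) = walsh S x := by
  refine Finset.prod_congr rfl fun j hj => ?_
  have : j ≠ i := fun h => hi (h ▸ hj)
  simp [flipCoord, this]

/-- Bonami's inequality with noise `ρ`, `ρ² = 1/3`, for functions depending on the coordinates in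
`I` only. In the inductive step a new coordinate `i` splits the function as `h + ρ x_i k` with `h`
and `k` independent of `x_i`, so odd powers of `x_i` cancel. -/
theorem cubeMean_noise_pow_four_le {n : ℕ} {ρ : ℝ} (hρ : ρ ^ 2 = 1 / 3) (I : Finset (Fin n)) :
    ∀ a : Finset (Fin n) → ℝ,
      cubeMean (fun x => (∑ S ∈ I.powerset, a S * ρ ^ S.card * walsh S x) ^ 4) ≤
        (∑ S ∈ I.powerset, a S ^ 2) ^ 2 := by
  induction I using Finset.induction_on with
  | empty =>
    intro a
    simp only [Finset.powerset_empty, Finset.sum_singleton, Finset.card_empty, pow_zero, mul_one]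
    refine le_of_eq ?_
    simp only [walsh, Finset.prod_empty, mul_one, cubeMean_const]
    ring
  | insert i I hi ih =>
    intro a
    set b : Finset (Fin n) → ℝ := fun S => a (insert i S) with hb
    set h : Cube n → ℝ := fun x => ∑ S ∈ I.powerset, a S * ρ ^ S.card * walsh S x with hh
    set k : Cube n → ℝ := fun x => ∑ S ∈ I.powerset, b S * ρ ^ S.card * walsh S x with hk
    have hsplit : ∀ x, ∑ S ∈ (insert i I).powerset, a S * ρ ^ S.card * walsh S x =
        h x + ρ * cubeVec x i * k x := by
      intro x
      rw [Finset.sum_powerset_insert hi, hh, hk]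
      simp only [Finset.mul_sum]
      congr 1
      refine Finset.sum_congr rfl fun S hS => ?_
      have hiS : i ∉ S := fun h => hi (Finset.mem_powerset.1 hS h)
      rw [Finset.card_insert_of_notMem hiS, walsh, Finset.prod_insert hiS, hb, walsh, cubeVec]
      ring
    have hinv : ∀ (c : Finset (Fin n) → ℝ) (x : Cube n),
        ∑ S ∈ I.powerset, c S * ρ ^ S.card * walsh S (flipCoord i x) =
          ∑ S ∈ I.powerset, c S * ρ ^ S.card * walsh S x := fun c x =>
      Finset.sum_congr rfl fun S hS => by
        rw [walsh_flipCoord_of_notMem fun h => hi (Finset.mem_powerset.1 hS h)]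
    have hflip : ∀ x, cubeVec (flipCoord i x) i = -cubeVec x i := fun x => by
      simp [cubeVec, flipCoord]
    simp only [hsplit]
    have key : cubeMean (fun x => (h x + ρ * cubeVec x i * k x) ^ 4) =
        cubeMean (fun x => h x ^ 4) + 2 * cubeMean (fun x => h x ^ 2 * k x ^ 2) +
          1 / 9 * cubeMean (fun x => k x ^ 4) := by
      have h1 := cubeMean_flipCoord i fun x => (h x + ρ * cubeVec x i * k x) ^ 4
      rw [← cubeMean_const_mul, ← cubeMean_const_mul, ← cubeMean_add, ← cubeMean_add]
      have h2 : ∀ x, (h (flipCoord i x) + ρ * cubeVec (flipCoord i x) i * k (flipCoord i x)) ^ 4 =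
          (-1) * (h x + ρ * cubeVec x i * k x) ^ 4 +
            2 * (h x ^ 4 + 2 * (h x ^ 2 * k x ^ 2) + 1 / 9 * k x ^ 4) := by
        intro x
        have e1 : h (flipCoord i x) = h x := hinv a x
        have e2 : k (flipCoord i x) = k x := hinv b x
        have e3 := cubeVec_sq x i
        rw [e1, e2, hflip]
        have e4 : ρ ^ 4 = 1 / 9 := by rw [show ρ ^ 4 = (ρ ^ 2) ^ 2 by ring, hρ]; norm_num
        have e5 : cubeVec x i ^ 4 = 1 := by
          rw [show cubeVec x i ^ 4 = (cubeVec x i ^ 2) ^ 2 by ring, e3]; norm_num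
        have e6 : (h x + ρ * -cubeVec x i * k x) ^ 4 + (h x + ρ * cubeVec x i * k x) ^ 4 =
            2 * (h x ^ 4 + 6 * (ρ ^ 2 * cubeVec x i ^ 2) * (h x ^ 2 * k x ^ 2) +
              ρ ^ 4 * cubeVec x i ^ 4 * k x ^ 4) := by ring
        rw [e3, e4, e5, hρ] at e6
        linarith
      rw [show (fun x => (h (flipCoord i x) + ρ * cubeVec (flipCoord i x) i *
        k (flipCoord i x)) ^ 4) = _ from funext h2, cubeMean_add, cubeMean_const_mul,
        cubeMean_const_mul 2] at h1
      linarith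
    have hA := ih a
    have hB := ih b
    have hsum : ∑ S ∈ (insert i I).powerset, a S ^ 2 =
        ∑ S ∈ I.powerset, a S ^ 2 + ∑ S ∈ I.powerset, b S ^ 2 :=
      Finset.sum_powerset_insert hi _
    rw [key, hsum]
    set A := ∑ S ∈ I.powerset, a S ^ 2
    set B := ∑ S ∈ I.powerset, b S ^ 2
    have hA0 : 0 ≤ A := Finset.sum_nonneg fun _ _ => sq_nonneg _
    have hB0 : 0 ≤ B := Finset.sum_nonneg fun _ _ => sq_nonneg _
    have hk0 : 0 ≤ cubeMean fun x => k x ^ 4 := cubeMean_nonneg fun x => by positivity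
    have hcs := cubeMean_mul_sq_le (fun x => h x ^ 2) fun x => k x ^ 2
    simp only [← pow_mul, Nat.reduceMul] at hcs
    have hmix : cubeMean (fun x => h x ^ 2 * k x ^ 2) ≤ A * B := by
      refine le_of_sq_le_sq ?_ (by positivity)
      calc _ ≤ _ := hcs
        _ ≤ A ^ 2 * B ^ 2 := mul_le_mul hA hB hk0 (by positivity)
        _ = (A * B) ^ 2 := by ring
    nlinarith

/-- The `L₂`–`L₄` moment comparison for functions of degree at most `D`. -/
theorem cubeMean_walshSum_pow_four_le {n D : ℕ} {c : Finset (Fin n) → ℝ}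
    (hc : ∀ S, D < S.card → c S = 0) :
    cubeMean (fun x => walshSum c x ^ 4) ≤ 9 ^ D * cubeMean (fun x => walshSum c x ^ 2) ^ 2 := by
  have hl2 : cubeMean (fun x => walshSum c x ^ 2) = ∑ S, c S ^ 2 := l2NormSq_walshSum c
  set ρ : ℝ := √(1 / 3)
  have hρ : ρ ^ 2 = 1 / 3 := Real.sq_sqrt (by norm_num)
  have hρ0 : ρ ≠ 0 := by intro h; rw [h] at hρ; norm_num at hρ
  have h := cubeMean_noise_pow_four_le hρ (Finset.univ : Finset (Fin n))
    fun S => c S * (ρ ^ S.card)⁻¹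
  have e : ∀ S : Finset (Fin n), c S * (ρ ^ S.card)⁻¹ * ρ ^ S.card = c S := fun S => by
    field_simp
  simp only [e, Finset.powerset_univ] at h
  refine h.trans ?_
  have h9 : (9 : ℝ) ^ D = (3 ^ D) ^ 2 := by rw [← pow_mul, mul_comm, pow_mul]; norm_num
  rw [hl2, h9, ← mul_pow]
  refine pow_le_pow_left₀ (Finset.sum_nonneg fun _ _ => sq_nonneg _) ?_ 2
  rw [Finset.mul_sum]
  refine Finset.sum_le_sum fun S _ => ?_
  by_cases hS : D < S.card
  · simp [hc S hS]
  · have h3 : ((ρ ^ S.card)⁻¹) ^ 2 = (3 : ℝ) ^ S.card := by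
      rw [inv_pow, ← pow_mul, mul_comm, pow_mul, hρ]; simp
    rw [mul_pow, h3, mul_comm]
    exact mul_le_mul_of_nonneg_right (pow_le_pow_right₀ (by norm_num) (not_lt.1 hS)) (sq_nonneg _)

/-- Comparison of the second moment with the moment of order `p = 2k/(k+1) < 2`. It follows from
the `L₂`–`L₄` comparison by Hölder's inequality, interpolating `L₂` between `L_p` and `L₄`. -/
theorem cubeMean_sq_rpow_le {n D k : ℕ} (hk : 1 ≤ k) {c : Finset (Fin n) → ℝ}
    (hc : ∀ S, D < S.card → c S = 0) :
    cubeMean (fun x => walshSum c x ^ 2) ^ ((k : ℝ) / (k + 1)) ≤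
      9 ^ ((D : ℝ) / (k + 1)) *
        cubeMean fun x => (walshSum c x ^ 2) ^ ((k : ℝ) / (k + 1)) := by
  set g := walshSum c
  set κ : ℝ := (k : ℝ) / (k + 1)
  have hk0 : (0 : ℝ) < k := by exact_mod_cast hk
  have hE0 : 0 ≤ cubeMean fun x => g x ^ 2 := cubeMean_nonneg fun x => sq_nonneg _
  have hP0 : 0 ≤ cubeMean fun x => (g x ^ 2) ^ κ := cubeMean_nonneg fun x => by positivity
  rcases hE0.eq_or_lt with h0 | hpos
  · rw [← h0, Real.zero_rpow (by positivity)]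
    positivity
  have h4 := cubeMean_walshSum_pow_four_le hc
  -- Hölder's inequality with weights `s = (k+1)/(k+2)` and `1 - s = 1/(k+2)`.
  have hold : cubeMean (fun x => g x ^ 2) ≤
      cubeMean (fun x => (g x ^ 2) ^ κ) ^ (((k : ℝ) + 1) / (k + 2)) *
        cubeMean (fun x => g x ^ 4) ^ (1 / ((k : ℝ) + 2)) := by
    have hpq : Real.HolderConjugate (((k : ℝ) + 2) / (k + 1)) ((k : ℝ) + 2) := by
      rw [Real.holderConjugate_iff]
      constructor
      · rw [lt_div_iff₀ (by positivity)]; linarith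
      · field_simp; ring
    have w0 : (0 : ℝ) ≤ 1 / 2 ^ n := by positivity
    have := Real.inner_le_Lp_mul_Lq_of_nonneg (s := Finset.univ) hpq
      (f := fun x : Cube n => (1 / 2 ^ n * (g x ^ 2) ^ κ) ^ (((k : ℝ) + 1) / (k + 2)))
      (g := fun x : Cube n => (1 / 2 ^ n * g x ^ 4) ^ (1 / ((k : ℝ) + 2)))
      (fun x _ => by positivity) (fun x _ => by positivity)
    have e1 : ∀ x : Cube n, ((1 / 2 ^ n * (g x ^ 2) ^ κ) ^ (((k : ℝ) + 1) / (k + 2))) ^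
        (((k : ℝ) + 2) / (k + 1)) = 1 / 2 ^ n * (g x ^ 2) ^ κ := fun x => by
      rw [← Real.rpow_mul (by positivity),
        show ((k : ℝ) + 1) / (k + 2) * ((k + 2) / (k + 1)) = 1 by field_simp, Real.rpow_one]
    have e2 : ∀ x : Cube n, ((1 / 2 ^ n * g x ^ 4) ^ (1 / ((k : ℝ) + 2))) ^ ((k : ℝ) + 2) =
        1 / 2 ^ n * g x ^ 4 := fun x => by
      rw [← Real.rpow_mul (by positivity),
        show 1 / ((k : ℝ) + 2) * (k + 2) = 1 by field_simp, Real.rpow_one]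
    have e3 : ∀ x : Cube n, (1 / 2 ^ n * (g x ^ 2) ^ κ) ^ (((k : ℝ) + 1) / (k + 2)) *
        (1 / 2 ^ n * g x ^ 4) ^ (1 / ((k : ℝ) + 2)) = 1 / 2 ^ n * g x ^ 2 := fun x => by
      have hg : g x ^ 4 = (g x ^ 2) ^ (2 : ℝ) := by
        rw [Real.rpow_two]; ring
      rw [hg, Real.mul_rpow w0 (by positivity), Real.mul_rpow w0 (by positivity),
        ← Real.rpow_mul (sq_nonneg _), ← Real.rpow_mul (sq_nonneg _)]
      have a1 : (1 / 2 ^ n : ℝ) ^ (((k : ℝ) + 1) / (k + 2)) * (1 / 2 ^ n : ℝ) ^ (1 / ((k : ℝ) + 2)) =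
          1 / 2 ^ n := by
        rw [← Real.rpow_add (by positivity),
          show ((k : ℝ) + 1) / (k + 2) + 1 / (k + 2) = 1 by field_simp; ring, Real.rpow_one]
      have a2 : (g x ^ 2) ^ (κ * (((k : ℝ) + 1) / (k + 2))) * (g x ^ 2) ^ (2 * (1 / ((k : ℝ) + 2))) =
          g x ^ 2 := by
        rw [← Real.rpow_add_of_nonneg (sq_nonneg _) (by positivity) (by positivity),
          show κ * (((k : ℝ) + 1) / (k + 2)) + 2 * (1 / ((k : ℝ) + 2)) = 1 by
            simp only [κ]; field_simp, Real.rpow_one]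
      calc _ = ((1 / 2 ^ n : ℝ) ^ (((k : ℝ) + 1) / (k + 2)) *
            (1 / 2 ^ n : ℝ) ^ (1 / ((k : ℝ) + 2))) * ((g x ^ 2) ^ (κ * (((k : ℝ) + 1) / (k + 2))) *
            (g x ^ 2) ^ (2 * (1 / ((k : ℝ) + 2)))) := by ring
        _ = _ := by rw [a1, a2]
    simp only [e1, e2, e3, ← Finset.mul_sum, one_div_div] at this
    exact this
  set E := cubeMean fun x => g x ^ 2
  set P := cubeMean fun x => (g x ^ 2) ^ κ
  have h1 : E ≤ P ^ (((k : ℝ) + 1) / (k + 2)) * (9 ^ D * E ^ 2) ^ (1 / ((k : ℝ) + 2)) :=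
    hold.trans (mul_le_mul_of_nonneg_left
      (Real.rpow_le_rpow (cubeMean_nonneg fun x => by positivity) h4 (by positivity)) (by positivity))
  have h2 : (9 ^ D * E ^ 2 : ℝ) ^ (1 / ((k : ℝ) + 2)) =
      9 ^ ((D : ℝ) / (k + 2)) * E ^ (2 / ((k : ℝ) + 2)) := by
    rw [Real.mul_rpow (by positivity) (by positivity), ← Real.rpow_natCast 9 D,
      ← Real.rpow_mul (by norm_num), ← Real.rpow_natCast E 2, ← Real.rpow_mul hE0]
    norm_num [div_eq_mul_inv]
  rw [h2] at h1
  have h3 : E ^ ((k : ℝ) / (k + 2)) ≤ P ^ (((k : ℝ) + 1) / (k + 2)) * 9 ^ ((D : ℝ) / (k + 2)) := by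
    have hpp : 0 < E ^ (2 / ((k : ℝ) + 2)) := Real.rpow_pos_of_pos hpos _
    refine le_of_mul_le_mul_right ?_ hpp
    rw [← Real.rpow_add hpos, show (k : ℝ) / (k + 2) + 2 / (k + 2) = 1 by field_simp, Real.rpow_one]
    linarith
  have h5 := Real.rpow_le_rpow (by positivity) h3
    (show (0 : ℝ) ≤ ((k : ℝ) + 2) / (k + 1) by positivity)
  rw [← Real.rpow_mul hE0, Real.mul_rpow (by positivity) (by positivity), ← Real.rpow_mul hP0,
    ← Real.rpow_mul (by norm_num),
    show (k : ℝ) / (k + 2) * ((k + 2) / (k + 1)) = κ by simp only [κ]; field_simp,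
    show ((k : ℝ) + 1) / (k + 2) * ((k + 2) / (k + 1)) = 1 by field_simp,
    show (D : ℝ) / (k + 2) * ((k + 2) / (k + 1)) = D / (k + 1) by field_simp, Real.rpow_one] at h5
  linarith

/-! ### An entropy proof of the mixed norm inequality -/

section Entropy

variable {Ω J ι : Type*}

open Classical in
/-- For weights `c` on a finite set `s` whose elements `x` have coordinates `e i x`, `i : J`: the
marginal weight of the `T`-coordinates of `x`, the total weight of the points that share them. -/
noncomputable def marginal (s : Finset Ω) (e : J → Ω → ι) (c : Ω → ℝ) (T : Finset J) (x : Ω) : ℝ :=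
  ∑ y ∈ s with ∀ i ∈ T, e i y = e i x, c y

/-- The Shannon entropy of the `T`-coordinates of a random point with distribution `c`. -/
noncomputable def coordEntropy (s : Finset Ω) (e : J → Ω → ι) (c : Ω → ℝ) (T : Finset J) : ℝ :=
  -∑ x ∈ s, c x * Real.log (marginal s e c T x)

theorem marginal_pos {s : Finset Ω} {e : J → Ω → ι} {c : Ω → ℝ} (hc : ∀ x ∈ s, 0 < c x)
    (T : Finset J) {x : Ω} (hx : x ∈ s) : 0 < marginal s e c T x := by
  classical
  exact Finset.sum_pos (fun y hy => hc y (Finset.mem_filter.1 hy).1) ⟨x, by simp [hx]⟩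

theorem marginal_congr {s : Finset Ω} {e : J → Ω → ι} {c : Ω → ℝ} {T : Finset J} {x y : Ω}
    (h : ∀ i ∈ T, e i x = e i y) : marginal s e c T x = marginal s e c T y := by
  classical
  unfold marginal
  congr 1
  ext z
  simp only [Finset.mem_filter, and_congr_right_iff]
  exact fun _ => forall₂_congr fun i hi => by rw [h i hi]

/-- Normalizing by the marginal turns each class of points with equal `T`-coordinates into a
probability space, so that sums over points turn into sums over classes. -/
theorem sum_mul_div_marginal_eq_one {s : Finset Ω} {e : J → Ω → ι} {c : Ω → ℝ}
    (hc : ∀ x ∈ s, 0 < c x) (T : Finset J) {x : Ω} (hx : x ∈ s) [DecidablePred fun y =>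
      ∀ i ∈ T, e i y = e i x] :
    ∑ y ∈ s with ∀ i ∈ T, e i y = e i x, c y / marginal s e c T y = 1 := by
  have h1 : ∀ y ∈ s.filter (fun y => ∀ i ∈ T, e i y = e i x),
      c y / marginal s e c T y = c y / marginal s e c T x := fun y hy => by
    rw [marginal_congr (Finset.mem_filter.1 hy).2]
  rw [Finset.sum_congr rfl h1, ← Finset.sum_div,
    div_eq_one_iff_eq (marginal_pos hc T hx).ne', marginal]
  congr

/-- Jensen's inequality for the logarithm, in the form used below. -/
theorem sum_mul_log_le {s : Finset Ω} {c F : Ω → ℝ} (hc : ∀ x ∈ s, 0 < c x)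
    (hF : ∀ x ∈ s, 0 < F x) (h1 : ∑ x ∈ s, c x = 1) {B : ℝ} (hB : 0 < B)
    (h : ∑ x ∈ s, c x * F x ≤ B) : ∑ x ∈ s, c x * Real.log (F x) ≤ Real.log B := by
  calc ∑ x ∈ s, c x * Real.log (F x) ≤ ∑ x ∈ s, c x * (F x / B - 1 + Real.log B) := by
        refine Finset.sum_le_sum fun x hx => mul_le_mul_of_nonneg_left ?_ (hc x hx).le
        have := Real.log_le_sub_one_of_pos (div_pos (hF x hx) hB)
        rw [Real.log_div (hF x hx).ne' hB.ne'] at this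
        linarith
    _ = (∑ x ∈ s, c x * F x) / B + (Real.log B - 1) * ∑ x ∈ s, c x := by
        rw [Finset.sum_div, Finset.mul_sum, ← Finset.sum_add_distrib]
        exact Finset.sum_congr rfl fun x _ => by ring
    _ ≤ Real.log B := by
        have := (div_le_one hB).2 h
        rw [h1]; linarith

/-- Submodularity of entropy: conditioning on more coordinates (`W` instead of `U`) decreases the
conditional entropy of the coordinate `i`. -/
theorem coordEntropy_submodular [DecidableEq J] {s : Finset Ω} {e : J → Ω → ι} {c : Ω → ℝ}
    (hc : ∀ x ∈ s, 0 < c x) (h1 : ∑ x ∈ s, c x = 1) {U W : Finset J} (hUW : U ⊆ W) (i : J) :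
    coordEntropy s e c (insert i W) - coordEntropy s e c W ≤
      coordEntropy s e c (insert i U) - coordEntropy s e c U := by
  classical
  set M := marginal s e c with hM
  have hMp : ∀ T, ∀ x ∈ s, 0 < M T x := fun T x hx => marginal_pos hc T hx
  have hsum : ∑ x ∈ s, c x * (M (insert i U) x * M W x / (M U x * M (insert i W) x)) ≤ 1 := by
    -- The two marginals in the numerator are sums over `y` and `z`; exchange them with `x`.
    have hexp : ∀ x ∈ s, c x * (M (insert i U) x * M W x / (M U x * M (insert i W) x)) =
        ∑ y ∈ s, ∑ z ∈ s, if (∀ j ∈ insert i U, e j y = e j x) ∧ (∀ j ∈ W, e j z = e j x)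
          then c y * c z / M U x * (c x / M (insert i W) x) else 0 := by
      intro x hx
      have e1 : M (insert i U) x * M W x = ∑ y ∈ s, ∑ z ∈ s,
          if (∀ j ∈ insert i U, e j y = e j x) ∧ (∀ j ∈ W, e j z = e j x) then c y * c z else 0 := by
        simp only [hM, marginal]
        rw [Finset.sum_filter, Finset.sum_filter, Finset.sum_mul_sum]
        refine Finset.sum_congr rfl fun y _ => Finset.sum_congr rfl fun z _ => ?_
        rw [ite_zero_mul_ite_zero]
      rw [e1, Finset.sum_div, Finset.mul_sum]
      refine Finset.sum_congr rfl fun y _ => ?_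
      rw [Finset.sum_div, Finset.mul_sum]
      refine Finset.sum_congr rfl fun z _ => ?_
      split_ifs
      · have := (hMp U x hx).ne'
        have := (hMp (insert i W) x hx).ne'
        field_simp
      · simp
    rw [Finset.sum_congr rfl hexp, Finset.sum_comm]
    have hyz : ∀ y ∈ s, (∑ x ∈ s, ∑ z ∈ s,
        if (∀ j ∈ insert i U, e j y = e j x) ∧ (∀ j ∈ W, e j z = e j x)
          then c y * c z / M U x * (c x / M (insert i W) x) else 0) ≤ c y := by
      intro y hy
      rw [Finset.sum_comm]
      calc _ ≤ ∑ z ∈ s, if ∀ j ∈ U, e j z = e j y then c y * c z / M U y else 0 := by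
            refine Finset.sum_le_sum fun z hz => ?_
            have hnn : 0 ≤ c y * c z / M U y :=
              div_nonneg (mul_nonneg (hc y hy).le (hc z hz).le) (hMp U y hy).le
            by_cases hx0 : ∃ x0 ∈ s, (∀ j ∈ insert i U, e j y = e j x0) ∧
                ∀ j ∈ W, e j z = e j x0
            · obtain ⟨x0, hx0, hy0, hz0⟩ := hx0
              rw [if_pos fun j hj => (hz0 j (hUW hj)).trans
                (hy0 j (Finset.mem_insert_of_mem hj)).symm]
              calc _ ≤ ∑ x ∈ s, if ∀ j ∈ insert i W, e j x = e j x0 then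
                    c y * c z / M U y * (c x / M (insert i W) x) else 0 := by
                    refine Finset.sum_le_sum fun x hx => ?_
                    have hnn2 : 0 ≤ c y * c z / M U y * (c x / M (insert i W) x) :=
                      mul_nonneg hnn (div_nonneg (hc x hx).le (hMp _ x hx).le)
                    by_cases hc1 : (∀ j ∈ insert i U, e j y = e j x) ∧ ∀ j ∈ W, e j z = e j x
                    · rw [if_pos hc1, if_pos, hM, marginal_congr (x := x) (y := y) (T := U)
                        fun j hj => (hc1.1 j (Finset.mem_insert_of_mem hj)).symm]
                      intro j hj
                      rcases Finset.mem_insert.1 hj with rfl | hj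
                      · rw [← hc1.1 j (Finset.mem_insert_self _ _),
                          hy0 j (Finset.mem_insert_self _ _)]
                      · rw [← hc1.2 j hj, hz0 j hj]
                    · rw [if_neg hc1]
                      split_ifs
                      · exact hnn2
                      · exact le_rfl
                _ = c y * c z / M U y := by
                    rw [← Finset.sum_filter, ← Finset.mul_sum,
                      sum_mul_div_marginal_eq_one hc _ hx0, mul_one]
            · rw [Finset.sum_eq_zero fun x hx => if_neg fun h => hx0 ⟨x, hx, h⟩]
              split_ifs
              · exact hnn
              · exact le_rfl
        _ = c y := by
            rw [← Finset.sum_filter, ← Finset.sum_div, ← Finset.mul_sum]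
            exact mul_div_cancel_right₀ _ (hMp U y hy).ne'
    exact (Finset.sum_le_sum hyz).trans h1.le
  have hlog := sum_mul_log_le hc (fun x hx => div_pos (mul_pos (hMp (insert i U) x hx) (hMp W x hx))
    (mul_pos (hMp U x hx) (hMp (insert i W) x hx))) h1 one_pos hsum
  have hsplit : ∀ x ∈ s, c x * Real.log (M (insert i U) x * M W x / (M U x * M (insert i W) x)) =
      c x * Real.log (M (insert i U) x) + c x * Real.log (M W x) - c x * Real.log (M U x) -
        c x * Real.log (M (insert i W) x) := fun x hx => by
    rw [Real.log_div (mul_pos (hMp _ x hx) (hMp _ x hx)).ne' (mul_pos (hMp _ x hx) (hMp _ x hx)).ne',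
      Real.log_mul (hMp _ x hx).ne' (hMp _ x hx).ne',
      Real.log_mul (hMp _ x hx).ne' (hMp _ x hx).ne']
    ring
  rw [Finset.sum_congr rfl hsplit, Finset.sum_sub_distrib, Finset.sum_sub_distrib,
    Finset.sum_add_distrib, Real.log_one] at hlog
  simp only [coordEntropy]
  linarith

theorem coordEntropy_empty {s : Finset Ω} {e : J → Ω → ι} {c : Ω → ℝ} (h1 : ∑ x ∈ s, c x = 1) :
    coordEntropy s e c ∅ = 0 := by
  simp [coordEntropy, marginal, h1]

/-- Han's inequality: the last conditional entropies add up to at most the entropy. -/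
theorem sum_coordEntropy_sub_erase_le [DecidableEq J] {s : Finset Ω} {e : J → Ω → ι} {c : Ω → ℝ}
    (hc : ∀ x ∈ s, 0 < c x) (h1 : ∑ x ∈ s, c x = 1) (V : Finset J) :
    ∑ i ∈ V, (coordEntropy s e c V - coordEntropy s e c (V.erase i)) ≤ coordEntropy s e c V := by
  suffices H : ∀ T : Finset J, T ⊆ V →
      ∑ i ∈ T, (coordEntropy s e c V - coordEntropy s e c (V.erase i)) ≤ coordEntropy s e c T from
    H V subset_rfl
  intro T
  induction T using Finset.induction_on with
  | empty => intro _; rw [coordEntropy_empty h1, Finset.sum_empty]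
  | insert j T hj ih =>
    intro hT
    rw [Finset.sum_insert hj]
    have h2 := ih fun i hi => hT (Finset.mem_insert_of_mem hi)
    have h3 := coordEntropy_submodular (e := e) hc h1 (U := T) (W := V.erase j) (fun i hi =>
      Finset.mem_erase.2 ⟨fun h => hj (h ▸ hi), hT (Finset.mem_insert_of_mem hi)⟩) j
    rw [Finset.insert_erase (hT (Finset.mem_insert_self _ _))] at h3
    linarith

/-- Some `k` out of `m` coordinates carry at least the fraction `k / m` of the entropy. -/
theorem exists_card_eq_coordEntropy_ge [Fintype J] [DecidableEq J] {s : Finset Ω} {e : J → Ω → ι}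
    {c : Ω → ℝ} (hc : ∀ x ∈ s, 0 < c x) (h1 : ∑ x ∈ s, c x = 1) {k : ℕ} (hk : 1 ≤ k)
    (hkm : k ≤ Fintype.card J) :
    ∃ T : Finset J, T.card = k ∧
      (k : ℝ) / Fintype.card J * coordEntropy s e c Finset.univ ≤ coordEntropy s e c T := by
  induction hkm using Nat.decreasingInduction with
  | self =>
    refine ⟨Finset.univ, rfl, ?_⟩
    rw [div_self (by exact_mod_cast (by omega : Fintype.card J ≠ 0)), one_mul]
  | of_succ k hkm ih =>
    obtain ⟨T, hT, hH⟩ := ih (by omega)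
    have han := sum_coordEntropy_sub_erase_le (e := e) hc h1 T
    have hne : T.Nonempty := Finset.card_pos.1 (by omega)
    obtain ⟨i, hi, hle⟩ := Finset.exists_le_of_sum_le hne
      (f := fun i => coordEntropy s e c T - coordEntropy s e c (T.erase i))
      (g := fun _ => coordEntropy s e c T / (k + 1)) (by
        refine han.trans (le_of_eq ?_)
        rw [Finset.sum_const, hT, nsmul_eq_mul]
        push_cast
        field_simp)
    refine ⟨T.erase i, by rw [Finset.card_erase_of_mem hi, hT]; omega, ?_⟩
    have hk0 : (0 : ℝ) < k := by exact_mod_cast hk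
    have hm0 : (0 : ℝ) < Fintype.card J := by exact_mod_cast (by omega : 0 < Fintype.card J)
    have h5 : (k : ℝ) / (k + 1) * coordEntropy s e c T ≤ coordEntropy s e c (T.erase i) := by
      have : (k : ℝ) / (k + 1) * coordEntropy s e c T =
        coordEntropy s e c T - coordEntropy s e c T / (k + 1) := by field_simp; ring
      linarith
    refine le_trans ?_ h5
    have h6 := mul_le_mul_of_nonneg_left hH (by positivity : (0 : ℝ) ≤ (k : ℝ) / (k + 1))
    refine le_trans (le_of_eq ?_) h6
    push_cast
    field_simp

/-- The mixed norm inequality for arrays `w` whose points are determined by `m` coordinates. With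
`H` the entropy of the Gibbs distribution `c ∝ w ^ (m/(m+1))` one has
`log ∑ w ^ (m/(m+1)) = H + m/(m+1) · E log w`, while for each set `T` of coordinates the same
variational principle, applied to the classes of points with equal `T`-coordinates and inside the
classes, bounds the logarithm of the right-hand side from below. -/
theorem sum_rpow_le_of_class_sum_le [Fintype J] [DecidableEq J] {s : Finset Ω} {e : J → Ω → ι}
    (hinj : ∀ x ∈ s, ∀ y ∈ s, (∀ i, e i x = e i y) → x = y) {w : Ω → ℝ} (hw : ∀ x ∈ s, 0 < w x)
    {k : ℕ} (hk : 1 ≤ k) (hkm : k ≤ Fintype.card J) {Y : ℝ} (hY : 0 ≤ Y)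
    (h : ∀ T : Finset J, T.card = k → ∀ c : Ω → ℝ, (∀ x ∈ s, 0 < c x) →
      ∑ x ∈ s, c x * (marginal s e w T x ^ ((k : ℝ) / (k + 1)) / marginal s e c T x) ≤ Y) :
    ∑ x ∈ s, w x ^ ((Fintype.card J : ℝ) / (Fintype.card J + 1)) ≤
      Y ^ ((Fintype.card J : ℝ) * (k + 1) / (k * (Fintype.card J + 1))) := by
  classical
  rcases s.eq_empty_or_nonempty with rfl | hs
  · simpa using Real.rpow_nonneg hY _
  set m := Fintype.card J
  have hk0 : (0 : ℝ) < k := by exact_mod_cast hk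
  have hm0 : (0 : ℝ) < m := by exact_mod_cast (by omega : 0 < m)
  set q : ℝ := (m : ℝ) / (m + 1) with hq
  set κ : ℝ := (k : ℝ) / (k + 1) with hκ
  have hq0 : 0 < q := by positivity
  set Z := ∑ x ∈ s, w x ^ q with hZ
  have hwq : ∀ x ∈ s, 0 < w x ^ q := fun x hx => Real.rpow_pos_of_pos (hw x hx) _
  have hZ0 : 0 < Z := Finset.sum_pos hwq hs
  set c : Ω → ℝ := fun x => w x ^ q / Z with hc_def
  have hc : ∀ x ∈ s, 0 < c x := fun x hx => div_pos (hwq x hx) hZ0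
  have h1 : ∑ x ∈ s, c x = 1 := by rw [hc_def, ← Finset.sum_div, div_self hZ0.ne']
  obtain ⟨T, hT, hH⟩ := exists_card_eq_coordEntropy_ge (e := e) hc h1 hk hkm
  have hTY := h T hT c hc
  have hMw : ∀ x ∈ s, 0 < marginal s e w T x := fun x hx => marginal_pos hw T hx
  have hMc : ∀ x ∈ s, 0 < marginal s e c T x := fun x hx => marginal_pos hc T hx
  have hF : ∀ x ∈ s, 0 < marginal s e w T x ^ κ / marginal s e c T x := fun x hx =>
    div_pos (Real.rpow_pos_of_pos (hMw x hx) _) (hMc x hx)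
  have hY0 : 0 < Y := lt_of_lt_of_le
    (Finset.sum_pos (fun x hx => mul_pos (hc x hx) (hF x hx)) hs) hTY
  have hlog1 := sum_mul_log_le hc hF h1 hY0 hTY
  -- Inside the classes.
  have hG : ∀ x ∈ s, 0 < w x * marginal s e c T x / (c x * marginal s e w T x) := fun x hx =>
    div_pos (mul_pos (hw x hx) (hMc x hx)) (mul_pos (hc x hx) (hMw x hx))
  have hlog2 := sum_mul_log_le hc hG h1 one_pos (by
    have e1 : ∀ x ∈ s, c x * (w x * marginal s e c T x / (c x * marginal s e w T x)) =
        ∑ y ∈ s, if ∀ i ∈ T, e i x = e i y then c y * (w x / marginal s e w T x) else 0 := by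
      intro x hx
      have : marginal s e c T x = ∑ y ∈ s, if ∀ i ∈ T, e i x = e i y then c y else 0 := by
        rw [marginal, Finset.sum_filter]
        refine Finset.sum_congr rfl fun y _ => ?_
        by_cases hxy : ∀ i ∈ T, e i x = e i y
        · rw [if_pos hxy, if_pos fun i hi => (hxy i hi).symm]
        · rw [if_neg hxy, if_neg fun h => hxy fun i hi => (h i hi).symm]
      have e2 : c x * (w x * marginal s e c T x / (c x * marginal s e w T x)) =
          marginal s e c T x * (w x / marginal s e w T x) := by
        have := (hc x hx).ne'
        have := (hMw x hx).ne'
        field_simp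
      rw [e2, this, Finset.sum_mul]
      exact Finset.sum_congr rfl fun y _ => by rw [ite_zero_mul]
    rw [Finset.sum_congr rfl e1, Finset.sum_comm]
    refine (Finset.sum_le_sum fun y hy => ?_).trans h1.le
    rw [← Finset.sum_filter, ← Finset.mul_sum, sum_mul_div_marginal_eq_one hw T hy, mul_one])
  have s1 : ∀ x ∈ s, c x * Real.log (marginal s e w T x ^ κ / marginal s e c T x) =
      κ * (c x * Real.log (marginal s e w T x)) - c x * Real.log (marginal s e c T x) := fun x hx => by
    rw [Real.log_div (Real.rpow_pos_of_pos (hMw x hx) _).ne' (hMc x hx).ne',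
      Real.log_rpow (hMw x hx)]
    ring
  have s2 : ∀ x ∈ s, c x * Real.log (w x * marginal s e c T x / (c x * marginal s e w T x)) =
      c x * Real.log (w x) + c x * Real.log (marginal s e c T x) - c x * Real.log (c x) -
        c x * Real.log (marginal s e w T x) := fun x hx => by
    rw [Real.log_div (mul_pos (hw x hx) (hMc x hx)).ne' (mul_pos (hc x hx) (hMw x hx)).ne',
      Real.log_mul (hw x hx).ne' (hMc x hx).ne', Real.log_mul (hc x hx).ne' (hMw x hx).ne']
    ring
  have s3 : ∀ x ∈ s, c x * Real.log (c x) = q * (c x * Real.log (w x)) - Real.log Z * c x :=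
    fun x hx => by
    conv_lhs => rw [hc_def]
    rw [Real.log_div (hwq x hx).ne' hZ0.ne', Real.log_rpow (hw x hx)]
    ring
  have hHu : coordEntropy s e c Finset.univ = -∑ x ∈ s, c x * Real.log (c x) := by
    rw [coordEntropy]
    congr 1
    refine Finset.sum_congr rfl fun x hx => ?_
    congr 2
    rw [marginal]
    convert Finset.sum_singleton c x using 2
    ext y
    simp only [Finset.mem_filter, Finset.mem_univ, forall_const, Finset.mem_singleton]
    exact ⟨fun hy => hinj y hy.1 x hx hy.2, fun hy => by subst hy; exact ⟨hx, fun _ => rfl⟩⟩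
  rw [Finset.sum_congr rfl s1, Finset.sum_sub_distrib, ← Finset.mul_sum] at hlog1
  rw [Finset.sum_congr rfl s2, Finset.sum_sub_distrib, Finset.sum_sub_distrib,
    Finset.sum_add_distrib, Real.log_one] at hlog2
  have s4 : ∑ x ∈ s, c x * Real.log (c x) =
      q * ∑ x ∈ s, c x * Real.log (w x) - Real.log Z := by
    rw [Finset.sum_congr rfl s3, Finset.sum_sub_distrib, ← Finset.mul_sum, ← Finset.mul_sum, h1,
      mul_one]
  rw [hHu, s4] at hH
  rw [s4] at hlog2
  simp only [coordEntropy] at hH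
  set Ew := ∑ x ∈ s, c x * Real.log (w x)
  set EW := ∑ x ∈ s, c x * Real.log (marginal s e w T x)
  set Ep := ∑ x ∈ s, c x * Real.log (marginal s e c T x)
  set P := (m : ℝ) * (k + 1) / (k * (m + 1)) with hP
  have hP0 : 0 < P := by positivity
  have hfin : Real.log Z ≤ P * Real.log Y := by
    have hκ0 : 0 < κ := by positivity
    have a1 : κ * (Ew + Ep - (q * Ew - Real.log Z)) ≤ κ * EW :=
      mul_le_mul_of_nonneg_left (by linarith) hκ0.le
    have a2 : κ * (Ew + Ep - (q * Ew - Real.log Z)) - Ep ≤ Real.log Y := by linarith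
    have hκ1 : 1 - κ = 1 / (k + 1) := by rw [hκ]; field_simp; ring
    have a3 : (1 - κ) * (k / m * -(q * Ew - Real.log Z)) ≤ (1 - κ) * -Ep :=
      mul_le_mul_of_nonneg_left hH (by rw [hκ1]; positivity)
    have a4 : κ * (Ew - (q * Ew - Real.log Z)) + (1 - κ) * (k / m * -(q * Ew - Real.log Z)) ≤
        Real.log Y := by linarith
    have a5 : κ * (Ew - (q * Ew - Real.log Z)) + (1 - κ) * (k / m * -(q * Ew - Real.log Z)) =
        Real.log Z / P := by
      rw [hκ1, hκ, hq, hP]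
      field_simp
      ring
    rw [a5, div_le_iff₀ hP0] at a4
    linarith
  rw [← Real.log_rpow hY0] at hfin
  exact (Real.log_le_log_iff hZ0 (Real.rpow_pos_of_pos hY0 _)).1 hfin

end Entropy

/-- Blei's mixed norm inequality for arrays indexed by `m`-element sets; the coordinates of a set
are its elements in increasing order. -/
theorem sum_card_eq_rpow_le {α : Type*} [Fintype α] [LinearOrder α] {w : Finset α → ℝ}
    (hw : ∀ S, 0 ≤ w S) {k m : ℕ} (hk : 1 ≤ k) (hkm : k ≤ m) :
    ∑ S : Finset α with S.card = m, w S ^ ((m : ℝ) / (m + 1)) ≤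
      (∑ V : Finset α with V.card = k,
        (∑ S : Finset α with V ⊆ S ∧ S.card = m, w S) ^ ((k : ℝ) / (k + 1))) ^
          ((m : ℝ) * (k + 1) / (k * (m + 1))) := by
  classical
  set Y := ∑ V : Finset α with V.card = k,
        (∑ S : Finset α with V ⊆ S ∧ S.card = m, w S) ^ ((k : ℝ) / (k + 1)) with hYdef
  have hin : ∀ V : Finset α, 0 ≤ ∑ S : Finset α with V ⊆ S ∧ S.card = m, w S := fun V =>
    Finset.sum_nonneg fun S _ => hw S
  have hY : 0 ≤ Y := Finset.sum_nonneg fun V _ => Real.rpow_nonneg (hin V) _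
  let e : Fin m → {S : Finset α // S.card = m} → α := fun i S => S.1.orderEmbOfFin S.2 i
  set s : Finset {S : Finset α // S.card = m} := Finset.univ.filter fun S => 0 < w S.1 with hs
  have hinj : ∀ x ∈ s, ∀ y ∈ s, (∀ i, e i x = e i y) → x = y := fun x _ y _ hxy => by
    apply Subtype.ext
    have hx := Finset.range_orderEmbOfFin x.1 x.2
    have hy := Finset.range_orderEmbOfFin y.1 y.2
    have : (⇑(x.1.orderEmbOfFin x.2)) = ⇑(y.1.orderEmbOfFin y.2) := funext hxy
    rw [this, hy] at hx
    exact (Finset.coe_injective hx).symm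
  -- Points agree on the coordinates `T` iff their `T`-coordinates form the same set.
  have himg : ∀ (T : Finset (Fin m)) (x y : {S : Finset α // S.card = m}),
      T.image (fun i => e i x) = T.image (fun i => e i y) → ∀ i ∈ T, e i x = e i y := by
    intro T x y hxy i hi
    have hcard : ∀ z, (T.image fun i => e i z).card = T.card := fun z =>
      Finset.card_image_of_injective _ (z.1.orderEmbOfFin z.2).injective
    have hu : ∀ z : {S : Finset α // S.card = m},
        (fun j => e (T.orderEmbOfFin rfl j) z) =
          (T.image fun i => e i z).orderEmbOfFin (hcard z) := fun z =>
      Finset.orderEmbOfFin_unique (hcard z)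
        (fun j => Finset.mem_image_of_mem _ (Finset.orderEmbOfFin_mem T rfl j))
        ((z.1.orderEmbOfFin z.2).strictMono.comp (T.orderEmbOfFin rfl).strictMono)
    obtain ⟨j, hj⟩ : ∃ j, T.orderEmbOfFin rfl j = i := by
      have := Finset.range_orderEmbOfFin T rfl
      have h' : i ∈ (T : Set (Fin m)) := hi
      rwa [← this] at h'
    have h3 := congrFun (hu x) j
    have h4 := congrFun (hu y) j
    simp only [hj] at h3 h4
    rw [h3, h4]
    have : ∀ (A B : Finset α) (hA : A.card = T.card) (hB : B.card = T.card), A = B →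
        A.orderEmbOfFin hA j = B.orderEmbOfFin hB j := by
      rintro A _ hA hB rfl; rfl
    exact this _ _ _ _ hxy
  have key := sum_rpow_le_of_class_sum_le (s := s) (e := e) hinj (w := fun S => w S.1)
    (fun x hx => (Finset.mem_filter.1 hx).2) hk (by simpa using hkm) hY (by
      intro T hT c hc
      have hfib : ∀ x ∈ s, T.image (fun i => e i x) ∈ Finset.univ.filter fun V : Finset α =>
          V.card = k := fun x _ => by
        rw [Finset.mem_filter, ← hT]
        exact ⟨Finset.mem_univ _,
          Finset.card_image_of_injective _ (x.1.orderEmbOfFin x.2).injective⟩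
      rw [← Finset.sum_fiberwise_of_maps_to hfib]
      refine Finset.sum_le_sum fun V _ => ?_
      rcases (s.filter fun x => T.image (fun i => e i x) = V).eq_empty_or_nonempty with he | ⟨x0, hx0⟩
      · rw [he, Finset.sum_empty]
        exact Real.rpow_nonneg (hin V) _
      obtain ⟨hx0s, hx0V⟩ := Finset.mem_filter.1 hx0
      have hcls : (s.filter fun x => T.image (fun i => e i x) = V) =
          s.filter fun x => ∀ i ∈ T, e i x = e i x0 := by
        ext x
        simp only [Finset.mem_filter, and_congr_right_iff]
        intro _
        rw [← hx0V]
        exact ⟨himg T x x0, fun h => Finset.image_congr h⟩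
      rw [hcls]
      have hmw : ∀ x ∈ s.filter (fun x => ∀ i ∈ T, e i x = e i x0),
          c x * (marginal s e (fun S => w S.1) T x ^ ((k : ℝ) / (k + 1)) / marginal s e c T x) =
          marginal s e (fun S => w S.1) T x0 ^ ((k : ℝ) / (k + 1)) * (c x / marginal s e c T x) :=
        fun x hx => by
          rw [marginal_congr (Finset.mem_filter.1 hx).2]
          ring
      rw [Finset.sum_congr rfl hmw, ← Finset.mul_sum, sum_mul_div_marginal_eq_one hc T hx0s, mul_one]
      refine Real.rpow_le_rpow (Finset.sum_nonneg fun S _ => hw S.1) ?_ (by positivity)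
      rw [marginal]
      calc _ = ∑ S ∈ (s.filter fun y => ∀ i ∈ T, e i y = e i x0).image Subtype.val, w S := by
            rw [Finset.sum_image Subtype.val_injective.injOn]
            refine Finset.sum_congr ?_ fun _ _ => rfl
            congr
        _ ≤ _ := by
            refine Finset.sum_le_sum_of_subset_of_nonneg ?_ fun S _ _ => hw S
            intro S hS
            obtain ⟨y, hy, rfl⟩ := Finset.mem_image.1 hS
            refine Finset.mem_filter.2 ⟨Finset.mem_univ _, ?_, y.2⟩
            rw [← hx0V]
            intro v hv
            obtain ⟨i, hi, rfl⟩ := Finset.mem_image.1 hv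
            rw [← (Finset.mem_filter.1 hy).2 i hi]
            exact Finset.orderEmbOfFin_mem _ _ _)
  rw [Fintype.card_fin] at key
  refine le_trans (le_of_eq ?_) key
  have hm0 : (0 : ℝ) < m := by exact_mod_cast (by omega : 0 < m)
  calc _ = ∑ S : {S : Finset α // S.card = m}, w S.1 ^ ((m : ℝ) / (m + 1)) :=
        (Finset.sum_subtype _ (fun S => by simp) _)
    _ = _ := by
        rw [hs, Finset.sum_filter]
        refine Finset.sum_congr rfl fun S _ => ?_
        split_ifs with h0
        · rfl
        · rw [le_antisymm (not_lt.1 h0) (hw S.1), Real.zero_rpow (by positivity)]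

/-! ### Taylor coefficients of the multilinear extension -/

/-- The Walsh coefficients of the discrete derivative of `walshSum a` in the directions `V`. -/
def derivCoeff {n : ℕ} (a : Finset (Fin n) → ℝ) (V R : Finset (Fin n)) : ℝ :=
  if Disjoint V R then a (V ∪ R) else 0

theorem derivCoeff_eq_zero {n d : ℕ} {a : Finset (Fin n) → ℝ} (ha : ∀ S, d < S.card → a S = 0)
    (V R : Finset (Fin n)) (h : d < V.card + R.card) : derivCoeff a V R = 0 := by
  unfold derivCoeff
  split_ifs with hd
  · exact ha _ (by rwa [Finset.card_union_of_disjoint hd])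
  · rfl

theorem multiExt_derivCoeff_eq_zero {n d : ℕ} {a : Finset (Fin n) → ℝ}
    (ha : ∀ S, d < S.card → a S = 0) (V : Finset (Fin n)) (h : d < V.card) (z : Fin n → ℝ) :
    multiExt (derivCoeff a V) z = 0 :=
  Finset.sum_eq_zero fun R _ => by rw [derivCoeff_eq_zero ha V R (by omega), zero_mul]

/-- The Taylor expansion of the multilinear extension at `z`. -/
theorem multiExt_add_mul {n : ℕ} (a : Finset (Fin n) → ℝ) (z y : Fin n → ℝ) (s : ℝ) :
    multiExt a (fun i => z i + s * y i) =
      ∑ V, multiExt (derivCoeff a V) z * (∏ i ∈ V, y i) * s ^ V.card := by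
  have e1 : ∀ S : Finset (Fin n), a S * ∏ i ∈ S, (z i + s * y i) = ∑ V ∈ S.powerset,
      a S * (s ^ V.card * (∏ i ∈ V, y i) * ∏ i ∈ S \ V, z i) := fun S => by
    simp_rw [add_comm (z _)]
    rw [Finset.prod_add, Finset.mul_sum]
    refine Finset.sum_congr rfl fun V _ => ?_
    rw [Finset.prod_mul_distrib, Finset.prod_const]
  have e2 : ∀ V : Finset (Fin n), multiExt (derivCoeff a V) z * (∏ i ∈ V, y i) * s ^ V.card =
      ∑ R with Disjoint V R, a (V ∪ R) * (s ^ V.card * (∏ i ∈ V, y i) * ∏ i ∈ R, z i) := fun V => by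
    rw [multiExt, Finset.sum_mul, Finset.sum_mul, Finset.sum_filter]
    refine Finset.sum_congr rfl fun R _ => ?_
    unfold derivCoeff
    split_ifs <;> ring
  rw [multiExt, Finset.sum_congr rfl fun S _ => e1 S, Finset.sum_congr rfl fun V _ => e2 V,
    Finset.sum_sigma', Finset.sum_sigma']
  refine Finset.sum_bij' (fun p _ => ⟨p.2, p.1 \ p.2⟩) (fun p _ => ⟨p.1 ∪ p.2, p.1⟩) ?_ ?_ ?_ ?_ ?_
  · rintro ⟨S, V⟩ _
    simpa using Finset.disjoint_sdiff
  · rintro ⟨V, R⟩ _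
    exact Finset.mem_sigma.2 ⟨Finset.mem_univ _, Finset.mem_powerset.2 Finset.subset_union_left⟩
  · rintro ⟨S, V⟩ h
    simp only [Finset.mem_sigma, Finset.mem_univ, Finset.mem_powerset, true_and] at h
    simp [Finset.union_sdiff_of_subset h]
  · rintro ⟨V, R⟩ h
    simp only [Finset.mem_sigma, Finset.mem_univ, Finset.mem_filter, true_and] at h
    simp [Finset.union_sdiff_cancel_left h]
  · rintro ⟨S, V⟩ h
    simp only [Finset.mem_sigma, Finset.mem_univ, Finset.mem_powerset, true_and] at h
    simp [Finset.union_sdiff_of_subset h]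

open Polynomial in
theorem eval_one_iterate_derivative_T_le (d k : ℕ) :
    (derivative^[k] (Chebyshev.T ℝ d)).eval 1 ≤ ((d : ℝ) ^ 2) ^ k := by
  have h := Chebyshev.iterate_derivative_T_eval_one (R := ℝ) d k
  set X := (derivative^[k] (Chebyshev.T ℝ d)).eval 1
  have h1 : (1 : ℝ) ≤ ∏ l ∈ Finset.range k, (2 * (l : ℝ) + 1) := by
    refine (Finset.prod_const_one (s := Finset.range k)).symm.le.trans ?_
    exact Finset.prod_le_prod (fun _ _ => zero_le_one) fun l _ => by
      linarith [(Nat.cast_nonneg l : (0 : ℝ) ≤ l)]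
  push_cast at h
  have h2 : 0 ≤ ∏ l ∈ Finset.range k, ((d : ℝ) ^ 2 - (l : ℝ) ^ 2) ∧
      ∏ l ∈ Finset.range k, ((d : ℝ) ^ 2 - (l : ℝ) ^ 2) ≤ ((d : ℝ) ^ 2) ^ k := by
    by_cases hk : d < k
    · rw [Finset.prod_eq_zero (Finset.mem_range.2 hk) (sub_self _)]
      exact ⟨le_rfl, by positivity⟩
    · have hl : ∀ l ∈ Finset.range k, (0 : ℝ) ≤ (d : ℝ) ^ 2 - (l : ℝ) ^ 2 := fun l hl => by
        have : (l : ℝ) ≤ d := by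
          exact_mod_cast (Finset.mem_range.1 hl).le.trans (not_lt.1 hk)
        have := pow_le_pow_left₀ (Nat.cast_nonneg l) this 2
        linarith
      refine ⟨Finset.prod_nonneg hl, ?_⟩
      refine (Finset.prod_le_prod hl (g := fun _ => (d : ℝ) ^ 2) fun l _ => ?_).trans_eq (by simp)
      linarith [sq_nonneg (l : ℝ)]
  rw [← h] at h2
  have hX : 0 ≤ X := by
    by_contra! hX
    nlinarith [h2.1]
  nlinarith [h2.2]

open Polynomial in
/-- Markov's inequality at an end point of an interval: the coefficients of low order of a bounded
polynomial of degree `d` on `[0, r]` are polynomially bounded in `d`. -/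
theorem abs_coeff_le_of_forall_abs_le_one {d k : ℕ} {r : ℝ} (hr : 0 < r) {p : ℝ[X]}
    (hp : p.natDegree ≤ d) (hb : ∀ s ∈ Set.Icc 0 r, |p.eval s| ≤ 1) :
    |p.coeff k| ≤ (2 * (d : ℝ) ^ 2 / r) ^ k := by
  have main : ∀ q : ℝ[X], q.natDegree ≤ d → (∀ s ∈ Set.Icc 0 r, |q.eval s| ≤ 1) →
      (-1) ^ k * q.coeff k ≤ (2 * (d : ℝ) ^ 2 / r) ^ k := by
    intro q hq hqb
    set P : ℝ[X] := (q.comp (C (r / 2) * X)).comp (1 - X) with hP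
    have hdeg : P.degree ≤ d := by
      refine natDegree_le_iff_degree_le.1 ?_
      have h1 : (C (r / 2) * X : ℝ[X]).natDegree ≤ 1 := (natDegree_C_mul_le _ _).trans natDegree_X_le
      have h2 : (1 - X : ℝ[X]).natDegree ≤ 1 := by
        refine (natDegree_sub_le _ _).trans ?_
        simp
      calc P.natDegree ≤ q.natDegree * (C (r / 2) * X : ℝ[X]).natDegree *
            (1 - X : ℝ[X]).natDegree := by
            rw [hP, natDegree_comp, natDegree_comp]
        _ ≤ d * 1 * 1 := by gcongr
        _ = d := by ring
    have hbd : ∀ u ∈ Set.Icc (-1 : ℝ) 1, |P.eval u| ≤ 1 := fun u hu => by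
      rw [hP, eval_comp, eval_comp]
      simp only [eval_sub, eval_one, eval_X, eval_mul, eval_C]
      refine hqb _ ⟨mul_nonneg (by positivity) (by linarith [hu.2]), ?_⟩
      nlinarith [hu.1]
    have h := (Chebyshev.eval_iterate_derivative_le_of_forall_abs_le_one (k := k) le_rfl hdeg
      hbd).trans (eval_one_iterate_derivative_T_le d k)
    rw [hP, iterate_derivative_comp_one_sub_X, eval_mul, eval_comp] at h
    simp only [eval_pow, eval_neg, eval_one, eval_sub, eval_X, sub_self] at h
    rw [← coeff_zero_eq_eval_zero, coeff_iterate_derivative, zero_add, comp_C_mul_X_coeff,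
      Nat.descFactorial_self, nsmul_eq_mul] at h
    have hf : (1 : ℝ) ≤ k.factorial := by exact_mod_cast Nat.one_le_iff_ne_zero.2 k.factorial_ne_zero
    have hr2 : (0 : ℝ) < (r / 2) ^ k := by positivity
    set A := (-1) ^ k * q.coeff k
    have h' : k.factorial * (A * (r / 2) ^ k) ≤ ((d : ℝ) ^ 2) ^ k := by
      refine le_trans (le_of_eq ?_) h
      simp only [A]; ring
    have e : (2 * (d : ℝ) ^ 2 / r) ^ k = ((d : ℝ) ^ 2) ^ k / (r / 2) ^ k := by
      rw [← div_pow]; congr 1; field_simp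
    rw [e, le_div_iff₀ hr2]
    rcases le_or_gt (A * (r / 2) ^ k) 0 with h0 | h0
    · exact h0.trans (by positivity)
    · nlinarith
  have h1 := main p hp hb
  have h2 := main (-p) (by rwa [natDegree_neg]) fun s hs => by
    rw [eval_neg, abs_neg]; exact hb s hs
  rw [coeff_neg] at h2
  rcases neg_one_pow_eq_or ℝ k with h | h <;> rw [h] at h1 h2 <;> exact abs_le.2 ⟨by linarith, by linarith⟩

/-- At points at distance `1/(d+1)` from the boundary of the cube `[-1, 1]^n`, the homogeneous
Taylor polynomial of order `k` of a bounded multilinear polynomial of degree `d` is bounded by a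
power `d ^ O(k)`, instead of the exponential bound in `d` valid at the origin. -/
theorem abs_sum_taylor_le {n d k : ℕ} (hd : 1 ≤ d) {a : Finset (Fin n) → ℝ}
    (ha : ∀ S, d < S.card → a S = 0) (hb : ∀ x : Cube n, |walshSum a x| ≤ 1) {z y : Fin n → ℝ}
    (hz : ∀ i, |z i| ≤ (d : ℝ) / (d + 1)) (hy : ∀ i, |y i| ≤ 1) :
    |∑ V with V.card = k, multiExt (derivCoeff a V) z * ∏ i ∈ V, y i| ≤
      (2 * ((d : ℝ) + 1) * d ^ 2) ^ k := by
  classical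
  set p : Polynomial ℝ := ∑ V, Polynomial.monomial V.card
    (multiExt (derivCoeff a V) z * ∏ i ∈ V, y i) with hp
  have hdeg : p.natDegree ≤ d := by
    refine Polynomial.natDegree_sum_le_of_forall_le _ _ fun V _ => ?_
    by_cases hV : d < V.card
    · rw [multiExt_derivCoeff_eq_zero ha V hV]; simp
    · exact (Polynomial.natDegree_monomial_le _).trans (not_lt.1 hV)
  have hr : (0 : ℝ) < 1 / (d + 1) := by positivity
  have hev : ∀ s ∈ Set.Icc (0 : ℝ) (1 / (d + 1)), |p.eval s| ≤ 1 := fun s hs => by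
    have : p.eval s = multiExt a (fun i => z i + s * y i) := by
      rw [multiExt_add_mul, hp, Polynomial.eval_finsetSum]
      simp
    rw [this]
    refine abs_multiExt_le hb fun i => ?_
    calc |z i + s * y i| ≤ |z i| + s * |y i| := by
          refine (abs_add_le _ _).trans_eq ?_
          rw [abs_mul, abs_of_nonneg hs.1]
      _ ≤ (d : ℝ) / (d + 1) + 1 / (d + 1) * 1 :=
          add_le_add (hz i) (mul_le_mul hs.2 (hy i) (abs_nonneg _) hr.le)
      _ = 1 := by field_simp
  have h := abs_coeff_le_of_forall_abs_le_one (k := k) hr hdeg hev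
  have hc : p.coeff k = ∑ V with V.card = k, multiExt (derivCoeff a V) z * ∏ i ∈ V, y i := by
    rw [hp, Polynomial.finsetSum_coeff, Finset.sum_filter]
    exact Finset.sum_congr rfl fun V _ => by rw [Polynomial.coeff_monomial]
  rw [hc] at h
  refine h.trans_eq ?_
  congr 1
  field_simp

/-! ### The Bohnenblust–Hille inequality -/

theorem multiExt_mul_cubeVec {n : ℕ} (b : Finset (Fin n) → ℝ) (t : ℝ) (x : Cube n) :
    multiExt b (fun i => t * cubeVec x i) = walshSum (fun R => b R * t ^ R.card) x := by
  refine Finset.sum_congr rfl fun R _ => ?_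
  rw [Finset.prod_mul_distrib, Finset.prod_const, mul_assoc]
  rfl

theorem one_le_nine_mul_div_pow {d : ℕ} (hd : 1 ≤ d) :
    1 ≤ 9 * ((d : ℝ) / (d + 1)) ^ (2 * d) := by
  have hd0 : (0 : ℝ) < d := by exact_mod_cast hd
  have h1 : ((d : ℝ) + 1) / d ≤ Real.exp (1 / d) := by
    have := Real.add_one_le_exp (1 / (d : ℝ))
    rwa [add_div, div_self hd0.ne', add_comm]
  have h2 : (((d : ℝ) + 1) / d) ^ (2 * d) ≤ 9 := by
    calc _ ≤ Real.exp (1 / d) ^ (2 * d) := pow_le_pow_left₀ (by positivity) h1 _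
      _ = Real.exp 1 ^ 2 := by
          rw [← Real.exp_nat_mul, ← Real.exp_nat_mul]
          congr 1
          push_cast
          field_simp
      _ ≤ 3 ^ 2 := pow_le_pow_left₀ (Real.exp_pos _).le (by linarith [Real.exp_one_lt_d9]) _
      _ = 9 := by norm_num
  have h3 : ((d : ℝ) / (d + 1)) ^ (2 * d) * (((d : ℝ) + 1) / d) ^ (2 * d) = 1 := by
    rw [← mul_pow, div_mul_div_comm, mul_comm, div_self (by positivity), one_pow]
  have h4 : 0 < ((d : ℝ) / (d + 1)) ^ (2 * d) := by positivity
  nlinarith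

/-- From Taylor coefficients of order `k` near the boundary of the cube to Walsh coefficients of
order `m`: hypercontractivity bounds the `ℓ₂` norm over the sets containing a given `V` with
`|V| = k` by a moment of the derivative in the directions `V`, and the mixed norm inequality
combines these bounds. -/
theorem sum_card_eq_sq_rpow_le {n d k m : ℕ} (hk : 1 ≤ k) (hkm : k ≤ m) (hmd : m ≤ d)
    {a : Finset (Fin n) → ℝ} (ha : ∀ S, d < S.card → a S = 0) {K : ℝ} (hK : 1 ≤ K)
    (h : ∀ x : Cube n, ∑ V with V.card = k,
      (multiExt (derivCoeff a V) (fun i => (d : ℝ) / (d + 1) * cubeVec x i) ^ 2) ^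
        ((k : ℝ) / (k + 1)) ≤ K) :
    ∑ S : Finset (Fin n) with S.card = m, (a S ^ 2) ^ ((m : ℝ) / (m + 1)) ≤
      (9 * 9 ^ ((d : ℝ) / (k + 1)) * K) ^ 2 := by
  classical
  have hd : 1 ≤ d := hk.trans (hkm.trans hmd)
  set t : ℝ := (d : ℝ) / (d + 1) with ht
  set κ : ℝ := (k : ℝ) / (k + 1) with hκ
  have hk0 : (0 : ℝ) < k := by exact_mod_cast hk
  have hm0 : (0 : ℝ) < m := by exact_mod_cast hk.trans hkm
  have ht0 : 0 < t := by
    have : (0 : ℝ) < d := by exact_mod_cast hd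
    positivity
  have ht1 : t ≤ 1 := by rw [ht, div_le_one (by positivity)]; linarith
  have hκ0 : 0 ≤ κ := by positivity
  have hκ1 : κ ≤ 1 := by rw [hκ, div_le_one (by positivity)]; linarith
  set c : Finset (Fin n) → Finset (Fin n) → ℝ := fun V R => derivCoeff a V R * t ^ R.card with hc
  set W : Finset (Fin n) → ℝ := fun V => ∑ S with V ⊆ S ∧ S.card = m, a S ^ 2 with hW
  have hW0 : ∀ V, 0 ≤ W V := fun V => Finset.sum_nonneg fun S _ => sq_nonneg _
  have hWc : ∀ V, t ^ (2 * d) * W V ≤ ∑ R, c V R ^ 2 := by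
    intro V
    rw [hW, Finset.mul_sum]
    calc _ ≤ ∑ S with V ⊆ S ∧ S.card = m, c V (S \ V) ^ 2 := by
          refine Finset.sum_le_sum fun S hS => ?_
          obtain ⟨hVS, hSm⟩ := (Finset.mem_filter.1 hS).2
          have e : c V (S \ V) = a S * t ^ (S \ V).card := by
            simp only [hc, derivCoeff]
            rw [if_pos Finset.disjoint_sdiff, Finset.union_sdiff_of_subset hVS]
          rw [e, mul_pow, ← pow_mul, mul_comm]
          refine mul_le_mul_of_nonneg_left ?_ (sq_nonneg _)
          refine pow_le_pow_of_le_one ht0.le ht1 ?_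
          have := Finset.card_le_card (Finset.sdiff_subset (s := S) (t := V))
          omega
      _ = ∑ R ∈ (Finset.univ.filter fun S => V ⊆ S ∧ S.card = m).image (· \ V), c V R ^ 2 := by
          rw [Finset.sum_image]
          intro S hS S' hS' hSS
          have h1 := (Finset.mem_filter.1 hS).2.1
          have h2 := (Finset.mem_filter.1 hS').2.1
          rw [← Finset.union_sdiff_of_subset h1, ← Finset.union_sdiff_of_subset h2]
          exact congrArg (V ∪ ·) hSS
      _ ≤ _ := Finset.sum_le_sum_of_subset_of_nonneg (Finset.subset_univ _)
          fun R _ _ => sq_nonneg _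
  have hhyp : ∀ V, t ^ (2 * d) * W V ^ κ ≤ 9 ^ ((d : ℝ) / (k + 1)) *
      cubeMean fun x => (walshSum (c V) x ^ 2) ^ κ := by
    intro V
    have h1 := cubeMean_sq_rpow_le (D := d) hk (c := c V) fun R hR => by
      simp only [hc]
      rw [derivCoeff_eq_zero ha V R (by omega), zero_mul]
    have h2 : cubeMean (fun x => walshSum (c V) x ^ 2) = ∑ R, c V R ^ 2 :=
      l2NormSq_walshSum (c V)
    rw [h2] at h1
    refine le_trans ?_ h1
    calc t ^ (2 * d) * W V ^ κ ≤ (t ^ (2 * d)) ^ κ * W V ^ κ := by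
          refine mul_le_mul_of_nonneg_right ?_ (Real.rpow_nonneg (hW0 V) _)
          exact Real.self_le_rpow_of_le_one (by positivity) (pow_le_one₀ ht0.le ht1) hκ1
      _ = (t ^ (2 * d) * W V) ^ κ := (Real.mul_rpow (by positivity) (hW0 V)).symm
      _ ≤ _ := Real.rpow_le_rpow (mul_nonneg (by positivity) (hW0 V)) (hWc V) hκ0
  have hsum : t ^ (2 * d) * ∑ V with V.card = k, W V ^ κ ≤ 9 ^ ((d : ℝ) / (k + 1)) * K := by
    rw [Finset.mul_sum]
    refine (Finset.sum_le_sum fun V _ => hhyp V).trans ?_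
    rw [← Finset.mul_sum, ← cubeMean_sum]
    refine mul_le_mul_of_nonneg_left ?_ (by positivity)
    refine (cubeMean_mono fun x => ?_).trans_eq (cubeMean_const K)
    refine le_trans (le_of_eq ?_) (h x)
    exact Finset.sum_congr rfl fun V _ => by rw [multiExt_mul_cubeVec]
  have hS0 : 0 ≤ ∑ V with V.card = k, W V ^ κ :=
    Finset.sum_nonneg fun V _ => Real.rpow_nonneg (hW0 V) _
  have hA : ∑ V with V.card = k, W V ^ κ ≤ 9 * 9 ^ ((d : ℝ) / (k + 1)) * K := by
    have := mul_le_mul_of_nonneg_right (one_le_nine_mul_div_pow hd) hS0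
    linarith
  have hblei := sum_card_eq_rpow_le (w := fun S => a S ^ 2) (fun S => sq_nonneg _) hk hkm
  have hA1 : 1 ≤ 9 * 9 ^ ((d : ℝ) / (k + 1)) * K := by
    have : (1 : ℝ) ≤ 9 ^ ((d : ℝ) / (k + 1)) := Real.one_le_rpow (by norm_num) (by positivity)
    nlinarith
  calc _ ≤ (∑ V with V.card = k, W V ^ κ) ^ ((m : ℝ) * (k + 1) / (k * (m + 1))) := hblei
    _ ≤ (9 * 9 ^ ((d : ℝ) / (k + 1)) * K) ^ ((m : ℝ) * (k + 1) / (k * (m + 1))) :=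
        Real.rpow_le_rpow hS0 hA (by positivity)
    _ ≤ (9 * 9 ^ ((d : ℝ) / (k + 1)) * K) ^ (2 : ℝ) := by
        refine Real.rpow_le_rpow_of_exponent_le hA1 ?_
        rw [div_le_iff₀ (by positivity)]
        have hk1 : (1 : ℝ) ≤ k := by exact_mod_cast hk
        nlinarith
    _ = _ := Real.rpow_two _

/-- A Bohnenblust–Hille inequality with a constant exponential in the degree, from the case
`k = 1` of `sum_card_eq_sq_rpow_le`. -/
theorem sum_card_eq_sq_rpow_le_exponential {n d m : ℕ} (hm : 1 ≤ m) (hmd : m ≤ d)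
    {a : Finset (Fin n) → ℝ} (ha : ∀ S, d < S.card → a S = 0)
    (hb : ∀ x : Cube n, |walshSum a x| ≤ 1) :
    ∑ S : Finset (Fin n) with S.card = m, (a S ^ 2) ^ ((m : ℝ) / (m + 1)) ≤
      81 * 9 ^ d * (2 * ((d : ℝ) + 1) * d ^ 2) ^ 2 := by
  classical
  have hd : 1 ≤ d := hm.trans hmd
  have hd1 : (1 : ℝ) ≤ d := by exact_mod_cast hd
  have hL : (1 : ℝ) ≤ 2 * ((d : ℝ) + 1) * d ^ 2 := by nlinarith
  have h := sum_card_eq_sq_rpow_le le_rfl hm hmd ha hL (by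
    intro x
    set z : Fin n → ℝ := fun i => (d : ℝ) / (d + 1) * cubeVec x i
    have hz : ∀ i, |z i| ≤ (d : ℝ) / (d + 1) := fun i => by
      rw [abs_mul, abs_cubeVec, mul_one, abs_of_nonneg (by positivity)]
    have hsg : ∀ r : ℝ, |(SignType.sign r : ℝ)| ≤ 1 := fun r => by
      rcases lt_trichotomy r 0 with h | h | h <;> simp [h]
    have := (le_abs_self _).trans (abs_sum_taylor_le (k := 1) hd ha hb hz
      (y := fun i => (SignType.sign (multiExt (derivCoeff a {i}) z) : ℝ)) fun i => hsg _)
    rw [pow_one] at this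
    refine le_trans (Finset.sum_le_sum fun V hV => le_of_eq ?_) this
    obtain ⟨i, rfl⟩ := Finset.card_eq_one.1 (Finset.mem_filter.1 hV).2
    rw [Finset.prod_singleton, self_mul_sign,
      show ((1 : ℕ) : ℝ) / ((1 : ℕ) + 1) = 1 / 2 by norm_num, ← Real.sqrt_eq_rpow,
      Real.sqrt_sq_eq_abs])
  refine h.trans_eq ?_
  have e : ((9 : ℝ) ^ ((d : ℝ) / ((1 : ℕ) + 1))) ^ 2 = 9 ^ d := by
    rw [← Real.rpow_natCast, ← Real.rpow_mul (by norm_num), ← Real.rpow_natCast]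
    congr 1
    push_cast
    ring
  rw [mul_pow, mul_pow, e]
  norm_num

/-- The Bohnenblust–Hille inequality for the homogeneous Taylor polynomial of order `k` at a point
`z`, with a constant `d ^ O(k)`. -/
theorem sum_taylor_sq_rpow_le {n d k : ℕ} (hk : 1 ≤ k) (hkd : k ≤ d)
    {a : Finset (Fin n) → ℝ} (ha : ∀ S, d < S.card → a S = 0)
    (hb : ∀ x : Cube n, |walshSum a x| ≤ 1) {z : Fin n → ℝ}
    (hz : ∀ i, |z i| ≤ (d : ℝ) / (d + 1)) :
    ∑ V with V.card = k, (multiExt (derivCoeff a V) z ^ 2) ^ ((k : ℝ) / (k + 1)) ≤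
      81 * 9 ^ k * (2 * ((d : ℝ) + 1) * d ^ 2) ^ (2 * k + 2) := by
  classical
  have hd : 1 ≤ d := hk.trans hkd
  have hd1 : (1 : ℝ) ≤ d := by exact_mod_cast hd
  set L : ℝ := 2 * ((d : ℝ) + 1) * d ^ 2 with hLdef
  have hL : 1 ≤ L := by nlinarith
  have hL0 : 0 < L := by linarith
  set κ : ℝ := (k : ℝ) / (k + 1) with hκ
  have hκ0 : 0 ≤ κ := by positivity
  have hκ1 : κ ≤ 1 := by rw [hκ, div_le_one (by positivity)]; linarith
  set b : Finset (Fin n) → ℝ := fun V =>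
    if V.card = k then multiExt (derivCoeff a V) z / L ^ k else 0 with hbdef
  have h := sum_card_eq_sq_rpow_le_exponential (d := k) (a := b) hk le_rfl
    (fun S hS => if_neg (by omega)) (fun x => by
      have h1 := abs_sum_taylor_le (k := k) hd ha hb hz (y := cubeVec x) fun i => (abs_cubeVec x i).le
      have : walshSum b x = (∑ V with V.card = k, multiExt (derivCoeff a V) z *
          ∏ i ∈ V, cubeVec x i) / L ^ k := by
        rw [walshSum, Finset.sum_div, Finset.sum_filter]
        refine Finset.sum_congr rfl fun V _ => ?_
        simp only [hbdef]
        split_ifs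
        · rw [div_mul_eq_mul_div]; rfl
        · rw [zero_mul]
      rw [this, abs_div, abs_of_pos (by positivity : 0 < L ^ k)]
      exact (div_le_one (by positivity)).2 h1)
  have hterm : ∀ V ∈ Finset.univ.filter (fun V : Finset (Fin n) => V.card = k),
      (multiExt (derivCoeff a V) z ^ 2) ^ κ ≤ L ^ (2 * k) * (b V ^ 2) ^ κ := by
    intro V hV
    have hbV : b V = multiExt (derivCoeff a V) z / L ^ k := if_pos (Finset.mem_filter.1 hV).2
    have e : multiExt (derivCoeff a V) z ^ 2 = L ^ (2 * k) * b V ^ 2 := by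
      rw [hbV, div_pow, ← pow_mul, mul_comm k 2]
      field_simp
    rw [e, Real.mul_rpow (by positivity) (sq_nonneg _)]
    refine mul_le_mul_of_nonneg_right ?_ (by positivity)
    calc (L ^ (2 * k)) ^ κ ≤ (L ^ (2 * k)) ^ (1 : ℝ) :=
          Real.rpow_le_rpow_of_exponent_le (one_le_pow₀ hL) hκ1
      _ = _ := Real.rpow_one _
  refine (Finset.sum_le_sum hterm).trans ?_
  rw [← Finset.mul_sum]
  have hLk : 2 * ((k : ℝ) + 1) * k ^ 2 ≤ L := by
    have : (k : ℝ) ≤ d := by exact_mod_cast hkd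
    rw [hLdef]
    gcongr
  calc _ ≤ L ^ (2 * k) * (81 * 9 ^ k * (2 * ((k : ℝ) + 1) * k ^ 2) ^ 2) :=
        mul_le_mul_of_nonneg_left h (by positivity)
    _ ≤ L ^ (2 * k) * (81 * 9 ^ k * L ^ 2) := by gcongr
    _ = _ := by ring

/-- The Bohnenblust–Hille inequality with a free parameter `k`: a large `k` makes the
hypercontractive constant `81 ^ (d/(k+1))` small, a small `k` the polarization constant
`d ^ O(k)`. -/
theorem sum_sq_rpow_le_of_param {n d k : ℕ} (hd : 1 ≤ d) (hk : 1 ≤ k)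
    {a : Finset (Fin n) → ℝ} (ha : ∀ S, d < S.card → a S = 0)
    (hb : ∀ x : Cube n, |walshSum a x| ≤ 1) :
    ∑ S, (a S ^ 2) ^ ((d : ℝ) / (d + 1)) ≤
      ((d : ℝ) + 1) * (9 * 9 ^ ((d : ℝ) / (k + 1)) *
        (81 * 9 ^ k * (2 * ((d : ℝ) + 1) * d ^ 2) ^ (2 * k + 2))) ^ 2 := by
  classical
  have hd1 : (1 : ℝ) ≤ d := by exact_mod_cast hd
  set L : ℝ := 2 * ((d : ℝ) + 1) * d ^ 2 with hLdef
  have hL : 1 ≤ L := by nlinarith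
  have h9 : (1 : ℝ) ≤ 9 ^ ((d : ℝ) / (k + 1)) := Real.one_le_rpow (by norm_num) (by positivity)
  set K : ℝ := 81 * 9 ^ k * L ^ (2 * k + 2) with hKdef
  have hK : 1 ≤ K := by
    have h1 : (1 : ℝ) ≤ 9 ^ k := one_le_pow₀ (by norm_num)
    have h2 : (1 : ℝ) ≤ L ^ (2 * k + 2) := one_le_pow₀ hL
    nlinarith
  set B : ℝ := (9 * 9 ^ ((d : ℝ) / (k + 1)) * K) ^ 2 with hBdef
  have hKB : K ≤ B := by
    have : K ≤ 9 * 9 ^ ((d : ℝ) / (k + 1)) * K := by nlinarith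
    rw [hBdef]
    nlinarith
  have hcoef : ∀ S, a S ^ 2 ≤ 1 := fun S => by
    rw [← congrFun (walshCoeff_walshSum a) S, sq_le_one_iff_abs_le_one, walshCoeff, abs_mul,
      abs_of_nonneg (by positivity)]
    calc _ ≤ 1 / 2 ^ n * ∑ y : Cube n, (1 : ℝ) := by
          refine mul_le_mul_of_nonneg_left ?_ (by positivity)
          refine (Finset.abs_sum_le_sum_abs _ _).trans (Finset.sum_le_sum fun y _ => ?_)
          rw [abs_mul, abs_walsh, mul_one]
          exact hb y
      _ = 1 := by simp
  have hlev : ∀ m ∈ Finset.range (d + 1),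
      ∑ S : Finset (Fin n) with S.card = m, (a S ^ 2) ^ ((d : ℝ) / (d + 1)) ≤ B := by
    intro m hm
    have hmd : m ≤ d := Nat.lt_succ_iff.1 (Finset.mem_range.1 hm)
    rcases Nat.eq_zero_or_pos m with rfl | hm1
    · simp only [Finset.card_eq_zero, Finset.filter_eq', Finset.mem_univ, if_true,
        Finset.sum_singleton]
      exact (Real.rpow_le_one (sq_nonneg _) (hcoef ∅) (by positivity)).trans (hK.trans hKB)
    have hstep : ∑ S : Finset (Fin n) with S.card = m, (a S ^ 2) ^ ((d : ℝ) / (d + 1)) ≤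
        ∑ S : Finset (Fin n) with S.card = m, (a S ^ 2) ^ ((m : ℝ) / (m + 1)) := by
      refine Finset.sum_le_sum fun S _ => ?_
      refine Real.rpow_le_rpow_of_exponent_ge_of_imp (sq_nonneg _) (hcoef S) ?_ fun _ h => ?_
      · rw [div_le_div_iff₀ (by positivity) (by positivity)]
        have : (m : ℝ) ≤ d := by exact_mod_cast hmd
        nlinarith
      · have hm0 : (0 : ℝ) < m := by exact_mod_cast hm1
        exact absurd h (by positivity)
    refine hstep.trans ?_
    rcases le_or_gt m k with hmk | hmk
    · -- At the origin the Taylor coefficients are the Walsh coefficients.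
      have h := sum_taylor_sq_rpow_le hm1 hmd ha hb (z := fun _ => 0) fun i => by
        rw [abs_zero]; positivity
      have e : ∀ V : Finset (Fin n), multiExt (derivCoeff a V) (fun _ => 0) = a V := fun V => by
        rw [multiExt, Finset.sum_eq_single ∅]
        · simp [derivCoeff]
        · intro R _ hR
          obtain ⟨i, hi⟩ := Finset.nonempty_iff_ne_empty.2 hR
          rw [Finset.prod_eq_zero hi rfl, mul_zero]
        · simp
      simp only [e] at h
      refine h.trans (le_trans ?_ hKB)
      rw [hKdef]
      gcongr
      · norm_num
    · refine sum_card_eq_sq_rpow_le hk hmk.le hmd ha hK fun x => ?_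
      refine sum_taylor_sq_rpow_le hk (hmk.le.trans hmd) ha hb fun i => ?_
      rw [abs_mul, abs_cubeVec, mul_one, abs_of_nonneg (by positivity)]
  have hzero : ∀ S : Finset (Fin n), S ∈ Finset.univ →
      (a S ^ 2) ^ ((d : ℝ) / (d + 1)) ≠ 0 → S.card ∈ Finset.range (d + 1) := by
    intro S _ hS
    by_contra hc
    rw [ha S (by simpa using hc), zero_pow two_ne_zero, Real.zero_rpow (by positivity)] at hS
    exact hS rfl
  rw [← Finset.sum_filter_of_ne hzero]
  rw [← Finset.sum_fiberwise_of_maps_to (t := Finset.range (d + 1)) (g := Finset.card)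
    fun S hS => (Finset.mem_filter.1 hS).2]
  calc _ ≤ ∑ m ∈ Finset.range (d + 1), B := by
        refine Finset.sum_le_sum fun m hm => (le_of_eq ?_).trans (hlev m hm)
        refine Finset.sum_congr ?_ fun _ _ => rfl
        ext S
        simp only [Finset.mem_filter, Finset.mem_univ, true_and]
        exact ⟨fun h => h.2, fun h => ⟨h ▸ hm, h⟩⟩
    _ = _ := by rw [Finset.sum_const, Finset.card_range, nsmul_eq_mul]; push_cast; rfl

/-- The Bohnenblust–Hille inequality on the cube with a constant subexponential in the degree. -/
theorem sum_sq_rpow_le {n d : ℕ} (hd : 1 ≤ d) {a : Finset (Fin n) → ℝ}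
    (ha : ∀ S, d < S.card → a S = 0) (hb : ∀ x : Cube n, |walshSum a x| ≤ 1) :
    ∑ S, (a S ^ 2) ^ ((d : ℝ) / (d + 1)) ≤
      Real.exp (121 * √(d * Real.log (max (d : ℝ) 2))) := by
  have hd1 : (1 : ℝ) ≤ d := by exact_mod_cast hd
  set M : ℝ := max (d : ℝ) 2 with hM
  have hM2 : 2 ≤ M := le_max_right _ _
  have hMd : (d : ℝ) ≤ M := le_max_left _ _
  set ℓ := Real.log M with hℓ
  have hℓ0 : 1 / 2 ≤ ℓ := by
    have := Real.log_le_log (by norm_num) hM2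
    linarith [Real.log_two_gt_d9]
  have hℓd : ℓ ≤ d := by
    rcases le_total (d : ℝ) 2 with h | h
    · rw [hℓ, hM, max_eq_right h]
      linarith [Real.log_two_lt_d9]
    · rw [hℓ, hM, max_eq_left h]
      exact Real.log_le_self (by positivity)
  set s := √(d * ℓ) with hs
  have hs2 : s ^ 2 = d * ℓ := Real.sq_sqrt (by positivity)
  have hs0 : 0 < s := Real.sqrt_pos.2 (by positivity)
  have hℓs : ℓ ≤ s := Real.le_sqrt_of_sq_le (by nlinarith)
  -- The optimal order is `√(d / ℓ) = s / ℓ`.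
  set k := ⌈s / ℓ⌉₊ with hk
  have hk1 : 1 ≤ k := Nat.one_le_ceil_iff.2 (by positivity)
  have hkl : s / ℓ ≤ k := Nat.le_ceil _
  have hku : (k : ℝ) < s / ℓ + 1 := Nat.ceil_lt_add_one (by positivity)
  have hkℓ : k * ℓ ≤ 2 * s := by
    have := mul_le_mul_of_nonneg_right hku.le (by linarith : 0 ≤ ℓ)
    rw [add_mul, div_mul_cancel₀ _ (by linarith)] at this
    linarith
  have hk4 : (k : ℝ) ≤ 4 * s := by nlinarith [(Nat.cast_nonneg k : (0 : ℝ) ≤ k)]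
  have hdk : (d : ℝ) / (k + 1) ≤ s := by
    rw [div_le_iff₀ (by positivity)]
    have h1 : s * (s / ℓ) = d := by
      rw [← mul_div_assoc, ← sq, hs2, mul_div_assoc, div_self (by linarith), mul_one]
    nlinarith
  refine (sum_sq_rpow_le_of_param hd hk1 ha hb).trans ?_
  have hM0 : 0 < M := by linarith
  have hMe : M = Real.exp ℓ := (Real.exp_log hM0).symm
  have h9 : (9 : ℝ) ≤ Real.exp 3 := by
    have h1 : Real.exp 3 = Real.exp 1 ^ 3 := by rw [← Real.exp_nat_mul]; norm_num
    have h2 : (2.1 : ℝ) ^ 3 ≤ Real.exp 1 ^ 3 :=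
      pow_le_pow_left₀ (by norm_num) (by linarith [Real.exp_one_gt_d9]) 3
    rw [h1]; norm_num at h2 ⊢; linarith
  have h81 : (81 : ℝ) ≤ Real.exp 6 := by
    have : Real.exp 6 = Real.exp 3 ^ 2 := by rw [← Real.exp_nat_mul]; norm_num
    rw [this]; nlinarith
  have hdp : (d : ℝ) + 1 ≤ Real.exp (2 * ℓ) := by
    rw [two_mul, Real.exp_add, ← hMe]; nlinarith
  have hL : 2 * ((d : ℝ) + 1) * d ^ 2 ≤ Real.exp (5 * ℓ) := by
    rw [show (5 : ℝ) * ℓ = (5 : ℕ) * ℓ by norm_num, Real.exp_nat_mul, ← hMe]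
    calc 2 * ((d : ℝ) + 1) * d ^ 2 ≤ M * (M ^ 2) * M ^ 2 := by gcongr; nlinarith
      _ = M ^ 5 := by ring
  have h9s : (9 : ℝ) ^ ((d : ℝ) / (k + 1)) ≤ Real.exp (3 * s) := by
    calc (9 : ℝ) ^ ((d : ℝ) / (k + 1)) ≤ 9 ^ s := Real.rpow_le_rpow_of_exponent_le (by norm_num) hdk
      _ ≤ Real.exp 3 ^ s := Real.rpow_le_rpow (by norm_num) h9 hs0.le
      _ = _ := by rw [← Real.exp_mul]
  calc _ ≤ Real.exp (2 * ℓ) * (Real.exp 3 * Real.exp (3 * s) *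
        (Real.exp 6 * Real.exp 3 ^ k * Real.exp (5 * ℓ) ^ (2 * k + 2))) ^ 2 := by gcongr
    _ = Real.exp (2 * ℓ + 2 * (3 + 3 * s + (6 + k * 3 + (2 * k + 2) * (5 * ℓ)))) := by
        rw [← Real.exp_nat_mul, ← Real.exp_nat_mul, ← Real.exp_add, ← Real.exp_add, ← Real.exp_add,
          ← Real.exp_add, ← Real.exp_nat_mul, ← Real.exp_add]
        congr 1
        push_cast
        ring
    _ ≤ _ := by
        refine Real.exp_le_exp.2 ?_
        nlinarith

/-! ### Probabilities as counts -/

theorem queryLaw_real_eq {n N m : ℕ} (s : Finset ((Fin m → Bool) × (Fin N → Cube n))) :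
    (queryLaw n N m).real s = (s.card : ℝ) / (2 ^ m * (2 ^ n) ^ N) := by
  have h1 : IsProbabilityMeasure (uniformOn Set.univ : Measure Bool) :=
    isProbabilityMeasure_uniformOn Set.finite_univ Set.univ_nonempty
  have h2 : IsProbabilityMeasure (cubeUniform n) :=
    isProbabilityMeasure_uniformOn Set.finite_univ Set.univ_nonempty
  have h3 : IsProbabilityMeasure (queryLaw n N m) := by unfold queryLaw; infer_instance
  have hs : ∀ ω : (Fin m → Bool) × (Fin N → Cube n),
      (queryLaw n N m).real {ω} = 1 / (2 ^ m * (2 ^ n) ^ N) := by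
    rintro ⟨u, v⟩
    have e1 : ∀ b : Bool, (uniformOn Set.univ : Measure Bool) {b} = 1 / 2 := fun b => by
      rw [uniformOn_univ]; simp
    have e2 : ∀ x : Cube n, cubeUniform n {x} = 1 / 2 ^ n := fun x => by
      rw [cubeUniform, uniformOn_univ, card_cube]; simp
    rw [Measure.real, queryLaw, ← Set.singleton_prod_singleton, Measure.prod_prod,
      Measure.pi_singleton, Measure.pi_singleton, Finset.prod_congr rfl fun i _ => e1 _,
      Finset.prod_congr rfl fun i _ => e2 _]
    simp [mul_comm]
  rw [← sum_measureReal_singleton, Finset.sum_congr rfl fun ω _ => hs ω]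
  rw [Finset.sum_const, nsmul_eq_mul, mul_one_div]

open Classical in
theorem one_sub_le_queryLaw_real {n N m : ℕ} {δ : ℝ}
    (S : Set ((Fin m → Bool) × (Fin N → Cube n)))
    (h : ((Finset.univ.filter fun ω => ω ∉ S).card : ℝ) ≤ δ * (2 ^ m * (2 ^ n) ^ N)) :
    1 - δ ≤ (queryLaw n N m).real S := by
  have hS : S = ((Finset.univ.filter fun ω => ω ∈ S : Finset _) : Set _) := by ext; simp
  rw [hS, queryLaw_real_eq, le_div_iff₀ (by positivity)]
  have hc := Finset.card_filter_add_card_filter_not (s := Finset.univ) fun ω => ω ∈ S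
  have ht : (Finset.univ : Finset ((Fin m → Bool) × (Fin N → Cube n))).card =
      2 ^ m * (2 ^ n) ^ N := by
    rw [Finset.card_univ, Fintype.card_prod, Fintype.card_fun, Fintype.card_fun, card_cube]
    simp
  rw [ht] at hc
  have hc' : ((Finset.univ.filter fun ω => ω ∈ S).card : ℝ) +
      (Finset.univ.filter fun ω => ω ∉ S).card = 2 ^ m * (2 ^ n) ^ N := by exact_mod_cast hc
  linarith

open Classical in
/-- A deterministic learner succeeds as soon as few samples are bad. -/
theorem exists_learner_of_card_le {n N : ℕ} {ε δ : ℝ} {F : Set (Cube n → ℝ)}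
    (A : (Fin N → Cube n × ℝ) → Cube n → ℝ)
    (hA : ∀ f ∈ F, ((Finset.univ.filter fun ω : Fin N → Cube n =>
      ε ≤ l2NormSq fun x => A (fun j => (ω j, f (ω j))) x - f x).card : ℝ) ≤ δ * (2 ^ n) ^ N) :
    ∃ A' : Learner n N 0, ∀ f ∈ F, 1 - δ ≤ (queryLaw n N 0).real
      {ω | l2NormSq (fun x => A'.hypothesis f ω x - f x) < ε} := by
  refine ⟨fun _ => A, fun f hf => one_sub_le_queryLaw_real _ ?_⟩
  rw [pow_zero, one_mul]
  refine le_trans ?_ (hA f hf)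
  have hinj : Set.InjOn (Prod.snd : (Fin 0 → Bool) × (Fin N → Cube n) → Fin N → Cube n)
      (Finset.univ.filter fun ω : (Fin 0 → Bool) × (Fin N → Cube n) => ω ∉
        {ω | l2NormSq (fun x => Learner.hypothesis (fun _ => A : Learner n N 0) f ω x - f x) < ε} :
        Finset _) := fun p _ q _ h => Prod.ext (Subsingleton.elim _ _) h
  rw [← Finset.card_image_of_injOn hinj]
  refine Nat.cast_le.2 (Finset.card_le_card fun ω hω => ?_)
  obtain ⟨p, hp, rfl⟩ := Finset.mem_image.1 hω
  rw [Finset.mem_filter, Set.mem_ofPred_eq, not_lt] at hp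
  exact Finset.mem_filter.2 ⟨Finset.mem_univ _, hp.2⟩

/-- The Chernoff bound for independent uniform points of the cube. -/
theorem card_le_sum_le {n N : ℕ} {g : Cube n → ℝ} (hg : ∀ x, |g x| ≤ 1) (h0 : ∑ x, g x = 0)
    (τ : ℝ) (hτ : 0 ≤ τ) :
    ((Finset.univ.filter fun ω : Fin N → Cube n => N * τ ≤ ∑ j, g (ω j)).card : ℝ) ≤
      Real.exp (-(N * τ ^ 2 / 2)) * (2 ^ n) ^ N := by
  have h1 : ∑ x : Cube n, Real.exp (τ * g x) ≤ 2 ^ n * Real.exp (τ ^ 2 / 2) := by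
    calc _ ≤ ∑ x : Cube n, (Real.cosh τ + g x * Real.sinh τ) := Finset.sum_le_sum fun x _ => by
          rw [mul_comm]; exact Real.exp_mul_le_cosh_add_mul_sinh (hg x) τ
      _ = 2 ^ n * Real.cosh τ := by
          rw [Finset.sum_add_distrib, ← Finset.sum_mul, h0, Finset.sum_const, Finset.card_univ,
            card_cube, nsmul_eq_mul]
          push_cast
          ring
      _ ≤ _ := mul_le_mul_of_nonneg_left (Real.cosh_le_exp_half_sq τ) (by positivity)
  have h2 : ∑ ω : Fin N → Cube n, Real.exp (τ * ∑ j, g (ω j)) =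
      (∑ x : Cube n, Real.exp (τ * g x)) ^ N := by
    simp_rw [Finset.mul_sum, Real.exp_sum]
    rw [← Fintype.piFinset_univ, ← Finset.prod_univ_sum (fun _ => Finset.univ)
      fun _ x => Real.exp (τ * g x)]
    simp
  have h3 : Real.exp (N * τ ^ 2) * ((Finset.univ.filter fun ω : Fin N → Cube n =>
      N * τ ≤ ∑ j, g (ω j)).card : ℝ) ≤ ∑ ω : Fin N → Cube n, Real.exp (τ * ∑ j, g (ω j)) := by
    rw [mul_comm, ← nsmul_eq_mul, ← Finset.sum_const]
    refine (Finset.sum_le_sum fun ω hω => ?_).trans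
      (Finset.sum_le_sum_of_subset_of_nonneg (Finset.filter_subset _ _)
        fun ω _ _ => (Real.exp_pos _).le)
    refine Real.exp_le_exp.2 ?_
    have := mul_le_mul_of_nonneg_left (Finset.mem_filter.1 hω).2 hτ
    nlinarith
  rw [h2] at h3
  have h4 : (∑ x : Cube n, Real.exp (τ * g x)) ^ N ≤
      (2 ^ n) ^ N * Real.exp (N * (τ ^ 2 / 2)) := by
    rw [Real.exp_nat_mul, ← mul_pow]
    exact pow_le_pow_left₀ (Finset.sum_nonneg fun x _ => (Real.exp_pos _).le) h1 N
  have h5 : Real.exp (-(N * τ ^ 2 / 2)) = Real.exp (N * (τ ^ 2 / 2)) / Real.exp (N * τ ^ 2) := by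
    rw [← Real.exp_sub]; congr 1; ring
  rw [h5, div_mul_eq_mul_div, le_div_iff₀ (Real.exp_pos _)]
  linarith

/-! ### Counting low-degree Walsh functions -/

/-- The index sets of the Walsh functions of degree at most `d`. -/
def lowDegreeSets (n d : ℕ) : Finset (Finset (Fin n)) := Finset.univ.filter fun S => S.card ≤ d

theorem mem_lowDegreeSets {n d : ℕ} {S : Finset (Fin n)} : S ∈ lowDegreeSets n d ↔ S.card ≤ d := by
  simp [lowDegreeSets]

theorem card_lowDegreeSets_succ (n d : ℕ) :
    (lowDegreeSets n (d + 1)).card = (lowDegreeSets n d).card + n.choose (d + 1) := by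
  have h : lowDegreeSets n (d + 1) =
      lowDegreeSets n d ∪ Finset.univ.filter fun S : Finset (Fin n) => S.card = d + 1 := by
    ext S
    simp only [mem_lowDegreeSets, Finset.mem_union, Finset.mem_filter, Finset.mem_univ, true_and]
    omega
  rw [h, Finset.card_union_of_disjoint]
  · congr 1
    rw [← Fintype.card_subtype, Fintype.card_finset_len, Fintype.card_fin]
  · refine Finset.disjoint_left.2 fun S h1 h2 => ?_
    rw [mem_lowDegreeSets] at h1
    have := (Finset.mem_filter.1 h2).2
    omega

theorem two_pow_mul_choose_le (n d : ℕ) : 2 ^ d * n.choose (d + 1) ≤ n ^ (d + 1) := by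
  have h1 : 2 ^ d ≤ (d + 1).factorial := by
    induction d with
    | zero => simp
    | succ d ih =>
      rw [pow_succ, Nat.factorial_succ, mul_comm]
      exact Nat.mul_le_mul (by omega) ih
  calc _ ≤ (d + 1).factorial * n.choose (d + 1) := Nat.mul_le_mul_right _ h1
    _ = n.descFactorial (d + 1) := (Nat.descFactorial_eq_factorial_mul_choose _ _).symm
    _ ≤ _ := Nat.descFactorial_le_pow _ _

theorem two_pow_mul_card_lowDegreeSets_le {n : ℕ} (hn : 2 ≤ n) (d : ℕ) :
    2 ^ d * (lowDegreeSets n (d + 1)).card ≤ (d + 1) * n ^ (d + 1) + 2 ^ d := by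
  induction d with
  | zero =>
    have h0 : (lowDegreeSets n 0).card = 1 := by
      rw [Finset.card_eq_one]
      exact ⟨∅, by ext S; simp [mem_lowDegreeSets]⟩
    rw [card_lowDegreeSets_succ, h0]
    simp [add_comm]
  | succ d ih =>
    rw [card_lowDegreeSets_succ]
    have h1 := two_pow_mul_choose_le n (d + 1)
    have h2 : 2 * ((d + 1) * n ^ (d + 1)) ≤ (d + 1) * n ^ (d + 2) := by
      calc _ ≤ n * ((d + 1) * n ^ (d + 1)) := Nat.mul_le_mul_right _ hn
        _ = _ := by ring
    calc _ = 2 * (2 ^ d * (lowDegreeSets n (d + 1)).card) + 2 ^ (d + 1) * n.choose (d + 1 + 1) := by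
          ring
      _ ≤ 2 * ((d + 1) * n ^ (d + 1) + 2 ^ d) + n ^ (d + 1 + 1) := by gcongr
      _ = 2 * ((d + 1) * n ^ (d + 1)) + n ^ (d + 2) + 2 ^ (d + 1) := by ring
      _ ≤ (d + 1) * n ^ (d + 2) + n ^ (d + 2) + 2 ^ (d + 1) := by gcongr
      _ = _ := by ring

theorem two_mul_card_lowDegreeSets_le {n d : ℕ} (hn : 2 ≤ n) (hd : 1 ≤ d) (hdn : d ≤ n) :
    2 * (lowDegreeSets n d).card ≤ n ^ (4 * d) := by
  obtain ⟨d, rfl⟩ : ∃ e, d = e + 1 := ⟨d - 1, by omega⟩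
  have h := two_pow_mul_card_lowDegreeSets_le hn d
  have h1 : (lowDegreeSets n (d + 1)).card ≤ (d + 1) * n ^ (d + 1) + 1 := by
    have h2 : 1 ≤ 2 ^ d := Nat.one_le_two_pow
    by_contra! hc
    nlinarith [Nat.mul_le_mul_left (2 ^ d) hc, Nat.zero_le ((d + 1) * n ^ (d + 1))]
  have hp : 1 ≤ n ^ (d + 1) := Nat.one_le_pow _ _ (by omega)
  calc 2 * (lowDegreeSets n (d + 1)).card ≤ 2 * (n * n ^ (d + 1) + n * n ^ (d + 1)) := by
        have : (d + 1) * n ^ (d + 1) ≤ n * n ^ (d + 1) := Nat.mul_le_mul_right _ hdn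
        nlinarith
    _ ≤ n * (n * (n * n ^ (d + 1))) := by
        calc _ = 4 * (n * n ^ (d + 1)) := by ring
          _ ≤ n * n * (n * n ^ (d + 1)) := Nat.mul_le_mul_right _ (Nat.mul_le_mul hn hn)
          _ = _ := by ring
    _ = n ^ (d + 4) := by ring
    _ ≤ n ^ (4 * (d + 1)) := Nat.pow_le_pow_right (by omega) (by omega)

/-! ### Learning by thresholding the empirical Walsh coefficients -/

/-- The empirical Walsh coefficient of labelled examples. -/
noncomputable def empiricalCoeff {n N : ℕ} (D : Fin N → Cube n × ℝ) (S : Finset (Fin n)) : ℝ :=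
  1 / N * ∑ j, (D j).2 * walsh S (D j).1

open Classical in
/-- The empirical Walsh expansion of degree at most `d`, restricted to the coefficients of absolute
value at least `2 * b`. -/
noncomputable def thresholdHypothesis {n N : ℕ} (d : ℕ) (b : ℝ) (D : Fin N → Cube n × ℝ) :
    Cube n → ℝ :=
  walshSum fun S => if S.card ≤ d ∧ 2 * b ≤ |empiricalCoeff D S| then empiricalCoeff D S else 0

/-- Discarding a coefficient or estimating it with error `b` costs at most a multiple of
`b ^ (2/(d+1)) |a_S| ^ (2d/(d+1))`, and the Bohnenblust–Hille inequality sums these costs. -/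
theorem l2NormSq_thresholdHypothesis_sub_le {n N d : ℕ} (hd : 1 ≤ d) {b : ℝ} (hb : 0 < b)
    (D : Fin N → Cube n × ℝ) {a : Finset (Fin n) → ℝ} (ha : ∀ S, d < S.card → a S = 0)
    (h : ∀ S ∈ lowDegreeSets n d, |empiricalCoeff D S - a S| < b) :
    l2NormSq (fun x => thresholdHypothesis d b D x - walshSum a x) ≤
      3 * (b ^ 2) ^ (1 / ((d : ℝ) + 1)) * ∑ S, (a S ^ 2) ^ ((d : ℝ) / (d + 1)) := by
  classical
  set c : Finset (Fin n) → ℝ := fun S =>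
    (if S.card ≤ d ∧ 2 * b ≤ |empiricalCoeff D S| then empiricalCoeff D S else 0) - a S with hc
  have e : (fun x => thresholdHypothesis d b D x - walshSum a x) = walshSum c := by
    funext x
    simp only [thresholdHypothesis, walshSum, hc, sub_mul, Finset.sum_sub_distrib]
  have hd0 : (1 : ℝ) ≤ d := by exact_mod_cast hd
  rw [e, l2NormSq_walshSum, Finset.mul_sum]
  refine Finset.sum_le_sum fun S _ => ?_
  have hsplit : ∀ r : ℝ, 0 ≤ r → r = r ^ (1 / ((d : ℝ) + 1)) * r ^ ((d : ℝ) / (d + 1)) :=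
    fun r hr => by
      rw [← Real.rpow_add_of_nonneg hr (by positivity) (by positivity),
        show 1 / ((d : ℝ) + 1) + d / (d + 1) = 1 by field_simp; ring, Real.rpow_one]
  have hnn : 0 ≤ 3 * (b ^ 2) ^ (1 / ((d : ℝ) + 1)) * (a S ^ 2) ^ ((d : ℝ) / (d + 1)) := by positivity
  by_cases hS : S.card ≤ d
  · have hS' := h S (mem_lowDegreeSets.2 hS)
    by_cases hsel : 2 * b ≤ |empiricalCoeff D S|
    · have hcS : c S = empiricalCoeff D S - a S := by simp only [hc]; rw [if_pos ⟨hS, hsel⟩]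
      have hab : b ≤ |a S| := by
        have := abs_sub_abs_le_abs_sub (empiricalCoeff D S) (a S)
        linarith
      have h1 : c S ^ 2 ≤ b ^ 2 := by rw [hcS]; exact sq_le_sq' (abs_lt.1 hS').1.le (abs_lt.1 hS').2.le
      have h2 : b ^ 2 ≤ a S ^ 2 := by rw [← sq_abs (a S)]; exact pow_le_pow_left₀ hb.le hab 2
      calc c S ^ 2 ≤ b ^ 2 := h1
        _ = (b ^ 2) ^ (1 / ((d : ℝ) + 1)) * (b ^ 2) ^ ((d : ℝ) / (d + 1)) := hsplit _ (sq_nonneg _)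
        _ ≤ (3 * (b ^ 2) ^ (1 / ((d : ℝ) + 1))) * (a S ^ 2) ^ ((d : ℝ) / (d + 1)) := by
            gcongr
            have : 0 ≤ (b ^ 2) ^ (1 / ((d : ℝ) + 1)) := by positivity
            linarith
    · have hcS : c S = -a S := by simp only [hc]; rw [if_neg fun h => hsel h.2, zero_sub]
      have hab : |a S| ≤ 3 * b := by
        have := abs_sub_abs_le_abs_sub (a S) (empiricalCoeff D S)
        rw [abs_sub_comm] at this
        linarith [not_le.1 hsel]
      have h2 : a S ^ 2 ≤ 9 * b ^ 2 := by
        rw [← sq_abs (a S)]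
        calc _ ≤ (3 * b) ^ 2 := pow_le_pow_left₀ (abs_nonneg _) hab 2
          _ = _ := by ring
      have h9 : (9 : ℝ) ^ (1 / ((d : ℝ) + 1)) ≤ 3 := by
        calc (9 : ℝ) ^ (1 / ((d : ℝ) + 1)) ≤ 9 ^ (1 / 2 : ℝ) := by
              refine Real.rpow_le_rpow_of_exponent_le (by norm_num) ?_
              exact one_div_le_one_div_of_le (by norm_num) (by linarith)
          _ = 3 := by
              rw [show (9 : ℝ) = 3 ^ (2 : ℝ) by norm_num, ← Real.rpow_mul (by norm_num)]
              norm_num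
      calc c S ^ 2 = a S ^ 2 := by rw [hcS, neg_sq]
        _ = (a S ^ 2) ^ (1 / ((d : ℝ) + 1)) * (a S ^ 2) ^ ((d : ℝ) / (d + 1)) :=
            hsplit _ (sq_nonneg _)
        _ ≤ (9 * b ^ 2) ^ (1 / ((d : ℝ) + 1)) * (a S ^ 2) ^ ((d : ℝ) / (d + 1)) := by gcongr
        _ = 9 ^ (1 / ((d : ℝ) + 1)) * (b ^ 2) ^ (1 / ((d : ℝ) + 1)) *
              (a S ^ 2) ^ ((d : ℝ) / (d + 1)) := by
            rw [Real.mul_rpow (by norm_num) (sq_nonneg _)]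
        _ ≤ _ := by gcongr
  · have hcS : c S = 0 := by
      simp only [hc]
      rw [if_neg fun h => hS h.1, ha S (by omega), sub_zero]
    rw [hcS, zero_pow two_ne_zero]
    exact hnn

/-- The empirical coefficients of degree at most `d` are simultaneously accurate for most samples. -/
theorem card_empiricalCoeff_bad_le {n N d : ℕ} (hN : 0 < N) {b : ℝ} (hb : 0 ≤ b) {f : Cube n → ℝ}
    (hf : ∀ x, |f x| ≤ 1) :
    ((Finset.univ.filter fun ω : Fin N → Cube n => ∃ S ∈ lowDegreeSets n d,
      b ≤ |empiricalCoeff (fun j => (ω j, f (ω j))) S - walshCoeff f S|).card : ℝ) ≤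
      2 * (lowDegreeSets n d).card * Real.exp (-(N * b ^ 2 / 8)) * (2 ^ n) ^ N := by
  classical
  have hN0 : (0 : ℝ) < N := by exact_mod_cast hN
  have hS : ∀ S ∈ lowDegreeSets n d, ((Finset.univ.filter fun ω : Fin N → Cube n =>
      b ≤ |empiricalCoeff (fun j => (ω j, f (ω j))) S - walshCoeff f S|).card : ℝ) ≤
      2 * Real.exp (-(N * b ^ 2 / 8)) * (2 ^ n) ^ N := by
    intro S _
    set g : Cube n → ℝ := fun x => (f x * walsh S x - walshCoeff f S) / 2 with hg
    have hfw : ∀ x, |f x * walsh S x| ≤ 1 := fun x => by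
      rw [abs_mul, abs_walsh, mul_one]; exact hf x
    have hco : |walshCoeff f S| ≤ 1 := by
      rw [walshCoeff, abs_mul, abs_of_nonneg (by positivity)]
      calc _ ≤ 1 / 2 ^ n * ∑ y : Cube n, (1 : ℝ) := by
            refine mul_le_mul_of_nonneg_left ?_ (by positivity)
            exact (Finset.abs_sum_le_sum_abs _ _).trans (Finset.sum_le_sum fun y _ => hfw y)
        _ = 1 := by simp
    have hg1 : ∀ x, |g x| ≤ 1 := fun x => by
      rw [hg, abs_div, abs_two, div_le_one two_pos]
      exact (abs_sub _ _).trans (by linarith [hfw x])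
    have hg0 : ∑ x, g x = 0 := by
      rw [hg, ← Finset.sum_div, Finset.sum_sub_distrib, Finset.sum_const, Finset.card_univ,
        card_cube, nsmul_eq_mul, walshCoeff]
      push_cast
      field_simp
      ring
    have hrel : ∀ ω : Fin N → Cube n, ∑ j, g (ω j) =
        N / 2 * (empiricalCoeff (fun j => (ω j, f (ω j))) S - walshCoeff f S) := fun ω => by
      simp only [hg, empiricalCoeff]
      rw [← Finset.sum_div, Finset.sum_sub_distrib, Finset.sum_const, Finset.card_univ,
        Fintype.card_fin, nsmul_eq_mul]
      field_simp
    have hup := card_le_sum_le (N := N) hg1 hg0 (b / 2) (by positivity)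
    have hlo := card_le_sum_le (N := N) (g := fun x => -g x) (fun x => by rw [abs_neg]; exact hg1 x)
      (by rw [Finset.sum_neg_distrib, hg0, neg_zero]) (b / 2) (by positivity)
    have hsub : (Finset.univ.filter fun ω : Fin N → Cube n =>
        b ≤ |empiricalCoeff (fun j => (ω j, f (ω j))) S - walshCoeff f S|) ⊆
        (Finset.univ.filter fun ω : Fin N → Cube n => N * (b / 2) ≤ ∑ j, g (ω j)) ∪
        (Finset.univ.filter fun ω : Fin N → Cube n => N * (b / 2) ≤ ∑ j, -g (ω j)) := by
      intro ω hω
      have hω := (Finset.mem_filter.1 hω).2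
      simp only [Finset.mem_union, Finset.mem_filter, Finset.mem_univ, true_and,
        Finset.sum_neg_distrib, hrel]
      rcases le_abs.1 hω with h | h
      · left; nlinarith
      · right; nlinarith
    have hcard : ((Finset.univ.filter fun ω : Fin N → Cube n =>
        b ≤ |empiricalCoeff (fun j => (ω j, f (ω j))) S - walshCoeff f S|).card : ℝ) ≤
        ((Finset.univ.filter fun ω : Fin N → Cube n => N * (b / 2) ≤ ∑ j, g (ω j)).card : ℝ) +
        ((Finset.univ.filter fun ω : Fin N → Cube n => N * (b / 2) ≤ ∑ j, -g (ω j)).card : ℝ) := by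
      exact_mod_cast (Finset.card_le_card hsub).trans (Finset.card_union_le _ _)
    rw [show (N : ℝ) * b ^ 2 / 8 = N * (b / 2) ^ 2 / 2 by ring]
    linarith
  have hun : (Finset.univ.filter fun ω : Fin N → Cube n => ∃ S ∈ lowDegreeSets n d,
      b ≤ |empiricalCoeff (fun j => (ω j, f (ω j))) S - walshCoeff f S|) ⊆
      (lowDegreeSets n d).biUnion fun S => Finset.univ.filter fun ω : Fin N → Cube n =>
        b ≤ |empiricalCoeff (fun j => (ω j, f (ω j))) S - walshCoeff f S| := by
    intro ω hω
    obtain ⟨S, hS, h⟩ := (Finset.mem_filter.1 hω).2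
    exact Finset.mem_biUnion.2 ⟨S, hS, Finset.mem_filter.2 ⟨Finset.mem_univ _, h⟩⟩
  calc _ ≤ ((∑ S ∈ lowDegreeSets n d, (Finset.univ.filter fun ω : Fin N → Cube n =>
        b ≤ |empiricalCoeff (fun j => (ω j, f (ω j))) S - walshCoeff f S|).card : ℕ) : ℝ) := by
        exact_mod_cast (Finset.card_le_card hun).trans Finset.card_biUnion_le
    _ ≤ ∑ S ∈ lowDegreeSets n d, 2 * Real.exp (-(N * b ^ 2 / 8)) * (2 ^ n) ^ N := by
        push_cast
        exact Finset.sum_le_sum hS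
    _ = _ := by rw [Finset.sum_const, nsmul_eq_mul]; ring

theorem exists_threshold_learner {ε δ : ℝ} (hε : ε ∈ Set.Ioo (0 : ℝ) 1)
    (hδ : δ ∈ Set.Ioo (0 : ℝ) 1) {n d N : ℕ} (hn : 2 ≤ n) (hd : 1 ≤ d) (hdn : d ≤ n)
    (hN : Real.exp (300 * (d : ℝ) ^ (3 / 2 : ℝ) * √(Real.log (max (d : ℝ) 2))) / ε ^ (d + 1) *
      Real.log ((n : ℝ) / δ) ≤ (N : ℝ)) :
    ∃ A : Learner n N 0, ∀ f ∈ {f : Cube n → ℝ | (∀ x, f x ∈ Set.Icc (-1 : ℝ) 1) ∧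
        DegreeAtMost d f},
      1 - δ ≤ (queryLaw n N 0).real {ω | l2NormSq (fun x => A.hypothesis f ω x - f x) < ε} := by
  classical
  obtain ⟨hε0, hε1⟩ := hε
  obtain ⟨hδ0, hδ1⟩ := hδ
  have hd1 : (1 : ℝ) ≤ d := by exact_mod_cast hd
  have hn2 : (2 : ℝ) ≤ n := by exact_mod_cast hn
  set ℓ := Real.log (max (d : ℝ) 2) with hℓ
  set s := √(d * ℓ) with hs
  set B := Real.exp (121 * s) with hB
  set Λ := Real.log ((n : ℝ) / δ) with hΛ
  have hΛ0 : 0 < Λ := Real.log_pos (by rw [one_lt_div hδ0]; linarith)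
  have hB0 : 0 < B := Real.exp_pos _
  -- The accuracy `b` of the coefficients satisfies `b ^ (2/(d+1)) = ε / (5 B)`.
  set β : ℝ := (ε / (5 * B)) ^ (d + 1) with hβ
  have hβ0 : 0 < β := by positivity
  set b := √β with hb
  have hb0 : 0 < b := Real.sqrt_pos.2 hβ0
  have hb2 : b ^ 2 = β := Real.sq_sqrt hβ0.le
  have hNβ : 4 * d * Λ ≤ N * b ^ 2 / 8 := by
    have hℓ1 : 1 / 2 ≤ ℓ := by
      have := Real.log_le_log (by norm_num) (le_max_right (d : ℝ) 2)
      linarith [Real.log_two_gt_d9]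
    have hs1 : 1 / 2 ≤ s := Real.le_sqrt_of_sq_le (by nlinarith)
    have hds : (d : ℝ) ^ (3 / 2 : ℝ) * √ℓ = d * s := by
      rw [hs, Real.sqrt_mul (by positivity), show (3 / 2 : ℝ) = 1 + 1 / 2 by norm_num,
        Real.rpow_add (by positivity), Real.rpow_one, ← Real.sqrt_eq_rpow]
      ring
    rw [mul_assoc 300, hds] at hN
    have hexp : 32 * d * (5 * B) ^ (d + 1) ≤ Real.exp (300 * (d * s)) := by
      have e1 : (32 : ℝ) ≤ Real.exp 5 := by
        have h1 : Real.exp 5 = Real.exp 1 ^ 5 := by rw [← Real.exp_nat_mul]; norm_num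
        have h2 : (2 : ℝ) ^ 5 ≤ Real.exp 1 ^ 5 :=
          pow_le_pow_left₀ (by norm_num) (by linarith [Real.exp_one_gt_d9]) 5
        rw [h1]; norm_num at h2 ⊢; linarith
      have e2 : (5 : ℝ) ≤ Real.exp 3 := by
        have h1 : Real.exp 3 = Real.exp 1 ^ 3 := by rw [← Real.exp_nat_mul]; norm_num
        have h2 : (2 : ℝ) ^ 3 ≤ Real.exp 1 ^ 3 :=
          pow_le_pow_left₀ (by norm_num) (by linarith [Real.exp_one_gt_d9]) 3
        rw [h1]; norm_num at h2 ⊢; linarith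
      have e3 : (d : ℝ) ≤ Real.exp d := by linarith [Real.add_one_le_exp (d : ℝ)]
      calc 32 * d * (5 * B) ^ (d + 1) ≤
            Real.exp 5 * Real.exp d * (Real.exp 3 * B) ^ (d + 1) := by gcongr
        _ = Real.exp (5 + d + (d + 1) * (3 + 121 * s)) := by
            rw [hB, ← Real.exp_add, ← Real.exp_add, ← Real.exp_nat_mul, ← Real.exp_add]
            push_cast
            rfl
        _ ≤ _ := by
            refine Real.exp_le_exp.2 ?_
            have h1 : s ≤ d * s := le_mul_of_one_le_left (by linarith) hd1
            have h2 : d * (1 / 2) ≤ d * s := mul_le_mul_of_nonneg_left hs1 (by linarith)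
            linarith
    have hkey : 32 * d ≤ Real.exp (300 * (d * s)) / ε ^ (d + 1) * β := by
      have : Real.exp (300 * (d * s)) / ε ^ (d + 1) * β =
          Real.exp (300 * (d * s)) / (5 * B) ^ (d + 1) := by
        rw [hβ, div_pow]; field_simp
      rw [this, le_div_iff₀ (by positivity)]
      exact hexp
    rw [hb2]
    have h1 := mul_le_mul_of_nonneg_right hkey hΛ0.le
    have h2 := mul_le_mul_of_nonneg_right hN hβ0.le
    nlinarith
  have hN0 : 0 < N := by
    rcases Nat.eq_zero_or_pos N with h | h
    · rw [h] at hNβ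
      have : 0 < 4 * d * Λ := by positivity
      norm_num at hNβ
      linarith
    · exact h
  refine exists_learner_of_card_le (thresholdHypothesis d b) fun f hf => ?_
  obtain ⟨hf1, hfd⟩ := hf
  have hfabs : ∀ x, |f x| ≤ 1 := fun x => abs_le.2 (hf1 x)
  have hbad := card_empiricalCoeff_bad_le (d := d) hN0 hb0.le hfabs
  have hsub : (Finset.univ.filter fun ω : Fin N → Cube n =>
      ε ≤ l2NormSq fun x => thresholdHypothesis d b (fun j => (ω j, f (ω j))) x - f x) ⊆
      Finset.univ.filter fun ω : Fin N → Cube n => ∃ S ∈ lowDegreeSets n d,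
        b ≤ |empiricalCoeff (fun j => (ω j, f (ω j))) S - walshCoeff f S| := by
    intro ω hω
    have hω := (Finset.mem_filter.1 hω).2
    refine Finset.mem_filter.2 ⟨Finset.mem_univ _, ?_⟩
    by_contra! hc
    have h1 := l2NormSq_thresholdHypothesis_sub_le hd hb0 (fun j => (ω j, f (ω j)))
      (a := walshCoeff f) hfd hc
    rw [walshSum_walshCoeff] at h1
    have h2 := sum_sq_rpow_le hd (a := walshCoeff f) hfd (by rwa [walshSum_walshCoeff])
    have h3 : (b ^ 2) ^ (1 / ((d : ℝ) + 1)) = ε / (5 * B) := by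
      rw [hb2, hβ, ← Real.rpow_natCast, ← Real.rpow_mul (by positivity)]
      push_cast
      rw [mul_one_div_cancel (by positivity), Real.rpow_one]
    rw [h3] at h1
    have h4 : 3 * (ε / (5 * B)) * ∑ S, (walshCoeff f S ^ 2) ^ ((d : ℝ) / (d + 1)) ≤
        3 * (ε / (5 * B)) * B := mul_le_mul_of_nonneg_left h2 (by positivity)
    have h5 : 3 * (ε / (5 * B)) * B = 3 / 5 * ε := by field_simp
    linarith
  calc _ ≤ _ := Nat.cast_le.2 (Finset.card_le_card hsub)
    _ ≤ _ := hbad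
    _ ≤ δ * (2 ^ n) ^ N := by
        refine mul_le_mul_of_nonneg_right ?_ (by positivity)
        have hM : (2 : ℝ) * (lowDegreeSets n d).card ≤ (n : ℝ) ^ (4 * d) := by
          exact_mod_cast two_mul_card_lowDegreeSets_le hn hd hdn
        have hexp : Real.exp (-(N * b ^ 2 / 8)) ≤ (δ / n) ^ (4 * d) := by
          calc _ ≤ Real.exp (-(4 * d * Λ)) := Real.exp_le_exp.2 (by linarith)
            _ = Real.exp (-Λ) ^ (4 * d) := by
                rw [← Real.exp_nat_mul]; congr 1; push_cast; ring
            _ = _ := by rw [hΛ, Real.exp_neg, Real.exp_log (by positivity), inv_div]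
        calc _ ≤ (n : ℝ) ^ (4 * d) * (δ / n) ^ (4 * d) := by gcongr
          _ = δ ^ (4 * d) := by rw [← mul_pow, mul_div_cancel₀ _ (by positivity)]
          _ ≤ δ ^ 1 := pow_le_pow_of_le_one hδ0.le hδ1.le (by omega)
          _ = δ := pow_one δ

/-! ### Learning by interpolation -/

/-- The space of functions on the cube of degree at most `d`. -/
noncomputable def lowDegree (n d : ℕ) : Submodule ℝ (Cube n → ℝ) :=
  Submodule.span ℝ ((fun S : Finset (Fin n) => walsh S) '' (lowDegreeSets n d : Set (Finset (Fin n))))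

theorem mem_lowDegree_of_degreeAtMost {n d : ℕ} {f : Cube n → ℝ} (hf : DegreeAtMost d f) :
    f ∈ lowDegree n d := by
  have e : f = ∑ S, walshCoeff f S • (walsh S : Cube n → ℝ) := by
    conv_lhs => rw [← walshSum_walshCoeff f]
    funext x
    simp [walshSum]
  rw [e]
  refine Submodule.sum_mem _ fun S _ => ?_
  by_cases hS : S.card ≤ d
  · exact Submodule.smul_mem _ _ (Submodule.subset_span ⟨S, mem_lowDegreeSets.2 hS, rfl⟩)
  · rw [hf S (not_le.1 hS), zero_smul]
    exact Submodule.zero_mem _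

theorem degreeAtMost_of_mem_lowDegree {n d : ℕ} {f : Cube n → ℝ} (hf : f ∈ lowDegree n d) :
    DegreeAtMost d f := by
  intro T hT
  induction hf using Submodule.span_induction with
  | mem g hg =>
    obtain ⟨S, hS, rfl⟩ := hg
    have hS : S.card ≤ d := mem_lowDegreeSets.1 hS
    have hne : S ≠ T := fun h => by subst h; omega
    simp only [walshCoeff]
    rw [sum_walsh_mul_walsh, if_neg hne, mul_zero]
  | zero => simp [walshCoeff]
  | add g h _ _ hg hh =>
    simp only [walshCoeff, Pi.add_apply, add_mul, Finset.sum_add_distrib, mul_add] at *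
    rw [hg, hh, add_zero]
  | smul c g _ hg =>
    simp only [walshCoeff, Pi.smul_apply, smul_eq_mul, mul_assoc, ← Finset.mul_sum] at *
    rw [mul_left_comm, hg, mul_zero]

theorem finrank_lowDegree_le (n d : ℕ) :
    Module.finrank ℝ (lowDegree n d) ≤ (lowDegreeSets n d).card := by
  classical
  rw [lowDegree, ← Finset.coe_image]
  exact (finrank_span_finset_le_card _).trans Finset.card_image_le

/-- A nonzero function of degree at most `d` is nonzero on at least `2 ^ (n - d)` points: if `S` is
maximal among the sets with nonzero Walsh coefficient, the restriction to each subcube in the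
directions `S` has the same nonzero top coefficient. -/
theorem two_pow_le_card_ne_zero {n d : ℕ} {f : Cube n → ℝ} (hf : DegreeAtMost d f) (h0 : f ≠ 0) :
    2 ^ (n - d) ≤ (Finset.univ.filter fun x => f x ≠ 0).card := by
  classical
  set a := walshCoeff f with ha
  have hfa : f = walshSum a := (walshSum_walshCoeff f).symm
  have hne : (Finset.univ.filter fun S => a S ≠ 0).Nonempty := by
    by_contra hc
    rw [Finset.not_nonempty_iff_eq_empty, Finset.filter_eq_empty_iff] at hc
    refine h0 ?_
    rw [hfa]
    funext x
    exact Finset.sum_eq_zero fun S hS => by rw [not_not.1 (hc hS), zero_mul]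
  obtain ⟨S, hS, hmax⟩ := Finset.exists_max_image _ Finset.card hne
  have hS0 : a S ≠ 0 := (Finset.mem_filter.1 hS).2
  have hSd : S.card ≤ d := by
    by_contra hc
    exact hS0 (hf S (not_le.1 hc))
  have hfib : ∀ x : Cube n, ∃ y, f y ≠ 0 ∧ ∀ i ∉ S, y i = x i := by
    intro x
    by_contra! hc
    have hz : ∀ u : Cube n, f (fun i => if i ∈ S then u i else x i) = 0 := fun u => by
      by_contra hne
      obtain ⟨i, hi, hi'⟩ := hc _ hne
      exact hi' (if_neg hi)
    have hw : ∀ R (u : Cube n), walsh R (fun i => if i ∈ S then u i else x i) =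
        walsh (R ∩ S) u * walsh (R \ S) x := fun R u => by
      rw [walsh, ← Finset.prod_inter_mul_prod_sdiff R S]
      congr 1
      · exact Finset.prod_congr rfl fun i hi => by rw [if_pos (Finset.mem_inter.1 hi).2]
      · exact Finset.prod_congr rfl fun i hi => by rw [if_neg (Finset.mem_sdiff.1 hi).2]
    have hsum : ∑ u : Cube n, f (fun i => if i ∈ S then u i else x i) * walsh S u =
        2 ^ n * a S := by
      rw [hfa]
      simp only [walshSum, hw, Finset.sum_mul]
      rw [Finset.sum_comm, Finset.sum_eq_single S]
      · have e : ∀ u : Cube n, a S * (walsh (S ∩ S) u * walsh (S \ S) x) * walsh S u =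
            a S * (walsh S u * walsh S u) := fun u => by
          rw [Finset.inter_self, Finset.sdiff_self]
          simp [walsh, mul_assoc]
        rw [Finset.sum_congr rfl fun u _ => e u, ← Finset.mul_sum, sum_walsh_mul_walsh, if_pos rfl,
          mul_comm]
      · intro R _ hR
        by_cases hSR : R ∩ S = S
        · have hlt : S.card < R.card :=
            Finset.card_lt_card (Finset.ssubset_iff_subset_ne.2
              ⟨Finset.inter_eq_right.1 hSR, fun h => hR h.symm⟩)
          have : a R = 0 := by
            by_contra hR0
            have := hmax R (Finset.mem_filter.2 ⟨Finset.mem_univ _, hR0⟩)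
            omega
          simp [this]
        · have e : ∀ u : Cube n, a R * (walsh (R ∩ S) u * walsh (R \ S) x) * walsh S u =
              a R * walsh (R \ S) x * (walsh (R ∩ S) u * walsh S u) := fun u => by ring
          rw [Finset.sum_congr rfl fun u _ => e u, ← Finset.mul_sum, sum_walsh_mul_walsh,
            if_neg hSR, mul_zero]
      · simp
    simp only [hz, zero_mul, Finset.sum_const_zero] at hsum
    exact mul_ne_zero (by positivity) hS0 hsum.symm
  -- Restriction to the coordinates outside `S` maps the support onto a cube.
  have hsurj : (Finset.univ.filter fun x => f x ≠ 0).image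
      (fun (x : Cube n) (i : {i // i ∉ S}) => x i.1) = Finset.univ := by
    refine Finset.eq_univ_iff_forall.2 fun v => ?_
    obtain ⟨y, hy, hyv⟩ := hfib fun i => if h : i ∉ S then v ⟨i, h⟩ else 1
    refine Finset.mem_image.2 ⟨y, Finset.mem_filter.2 ⟨Finset.mem_univ _, hy⟩, ?_⟩
    funext i
    simpa [i.2] using hyv i.1 i.2
  calc 2 ^ (n - d) ≤ 2 ^ (n - S.card) := Nat.pow_le_pow_right (by norm_num) (by omega)
    _ = (Finset.univ : Finset ({i // i ∉ S} → ℤˣ)).card := by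
        rw [Finset.card_univ, Fintype.card_fun, Fintype.card_units_int, Fintype.card_subtype_compl,
          Fintype.card_fin, Fintype.card_coe]
    _ ≤ _ := by rw [← hsurj]; exact Finset.card_image_le

/-- The functions vanishing at `x`. -/
def vanishingAt {n : ℕ} (x : Cube n) : Submodule ℝ (Cube n → ℝ) :=
  LinearMap.ker (LinearMap.proj x : (Cube n → ℝ) →ₗ[ℝ] ℝ)

theorem mem_vanishingAt {n : ℕ} {x : Cube n} {f : Cube n → ℝ} : f ∈ vanishingAt x ↔ f x = 0 :=
  LinearMap.mem_ker

/-- The potential that controls the dimension of the space of functions vanishing on the sample: it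
is at least `1` on nonzero dimensions and is halved whenever the dimension drops. -/
noncomputable def dimPotential (k : ℕ) : ℝ := if k = 0 then 0 else 2 ^ (k - 1)

theorem dimPotential_nonneg (k : ℕ) : 0 ≤ dimPotential k := by
  unfold dimPotential
  split_ifs <;> positivity

theorem dimPotential_mono {j k : ℕ} (h : j ≤ k) : dimPotential j ≤ dimPotential k := by
  unfold dimPotential
  split_ifs
  · exact le_rfl
  · positivity
  · omega
  · exact pow_le_pow_right₀ (by norm_num) (by omega)

theorem two_mul_dimPotential_le {j k : ℕ} (h : j < k) : 2 * dimPotential j ≤ dimPotential k := by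
  unfold dimPotential
  split_ifs
  · omega
  · simp
  · omega
  · rw [← pow_succ']
    exact pow_le_pow_right₀ (by norm_num) (by omega)

theorem sum_dimPotential_vanishingAt_le {n d : ℕ} (hdn : d ≤ n)
    {W : Submodule ℝ (Cube n → ℝ)} (hW : W ≤ lowDegree n d) :
    ∑ x : Cube n, dimPotential (Module.finrank ℝ ↥(W ⊓ vanishingAt x)) ≤
      2 ^ n * (1 - 1 / 2 ^ (d + 1)) * dimPotential (Module.finrank ℝ W) := by
  classical
  set φ := dimPotential (Module.finrank ℝ W) with hφ
  have hφ0 : 0 ≤ φ := dimPotential_nonneg _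
  rcases eq_or_ne W ⊥ with rfl | hne
  · have : ∀ x : Cube n, dimPotential (Module.finrank ℝ
        ↥((⊥ : Submodule ℝ (Cube n → ℝ)) ⊓ vanishingAt x)) = 0 := fun x => by
      rw [bot_inf_eq, finrank_bot]; simp [dimPotential]
    rw [Finset.sum_congr rfl fun x _ => this x, Finset.sum_const_zero]
    refine mul_nonneg (mul_nonneg (by positivity) (sub_nonneg.2 ?_)) hφ0
    exact (div_le_one (by positivity)).2 (one_le_pow₀ (by norm_num))
  obtain ⟨g, hgW, hg0⟩ := W.exists_mem_ne_zero_of_ne_bot hne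
  have hcard := two_pow_le_card_ne_zero (degreeAtMost_of_mem_lowDegree (hW hgW)) hg0
  have hx : ∀ x : Cube n, dimPotential (Module.finrank ℝ ↥(W ⊓ vanishingAt x)) ≤
      φ - if g x ≠ 0 then φ / 2 else 0 := by
    intro x
    split_ifs with hgx
    · have hlt : W ⊓ vanishingAt x < W := by
        refine lt_of_le_of_ne inf_le_left fun h => hgx ?_
        exact mem_vanishingAt.1 (h.symm.le hgW).2
      have := two_mul_dimPotential_le (Submodule.finrank_lt_finrank_of_lt hlt)
      linarith
    · rw [sub_zero]
      exact dimPotential_mono (Submodule.finrank_mono inf_le_left)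
  refine (Finset.sum_le_sum fun x _ => hx x).trans ?_
  rw [Finset.sum_sub_distrib, Finset.sum_const, Finset.card_univ, card_cube, ← Finset.sum_filter,
    Finset.sum_const, nsmul_eq_mul, nsmul_eq_mul]
  have h1 : (2 : ℝ) ^ n / 2 ^ d ≤ ((Finset.univ.filter fun x => g x ≠ 0).card : ℝ) := by
    rw [div_eq_mul_inv, ← pow_sub₀ _ two_ne_zero hdn]
    exact_mod_cast hcard
  have h2 := mul_le_mul_of_nonneg_right h1 (by positivity : 0 ≤ φ / 2)
  have h3 : (2 : ℝ) ^ n / 2 ^ d * (φ / 2) = 2 ^ n * (1 / 2 ^ (d + 1)) * φ := by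
    rw [pow_succ]; field_simp
  push_cast
  linarith

/-- The functions in `W` vanishing on all points of a sample. -/
def vanishingOn {n N : ℕ} (W : Submodule ℝ (Cube n → ℝ)) (ω : Fin N → Cube n) :
    Submodule ℝ (Cube n → ℝ) :=
  W ⊓ ⨅ j, vanishingAt (ω j)

theorem sum_dimPotential_vanishingOn_le {n d N : ℕ} (hdn : d ≤ n) :
    ∀ {W : Submodule ℝ (Cube n → ℝ)}, W ≤ lowDegree n d →
    ∑ ω : Fin N → Cube n, dimPotential (Module.finrank ℝ ↥(vanishingOn W ω)) ≤
      (2 ^ n * (1 - 1 / 2 ^ (d + 1))) ^ N * dimPotential (Module.finrank ℝ W) := by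
  induction N with
  | zero =>
    intro W _
    rw [pow_zero, one_mul, Fintype.sum_unique]
    exact dimPotential_mono (Submodule.finrank_mono inf_le_left)
  | succ N ih =>
    intro W hW
    have hc : (0 : ℝ) ≤ 1 - 1 / 2 ^ (d + 1) :=
      sub_nonneg.2 ((div_le_one (by positivity)).2 (one_le_pow₀ (by norm_num)))
    have hcons : ∀ (x : Cube n) (ω : Fin N → Cube n),
        vanishingOn W (Fin.cons x ω : Fin (N + 1) → Cube n) = vanishingOn (W ⊓ vanishingAt x) ω := by
      intro x ω
      ext g
      simp only [vanishingOn, Submodule.mem_inf, Submodule.mem_iInf, Fin.forall_fin_succ,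
        Fin.cons_zero, Fin.cons_succ, and_assoc]
    have e : ∑ ω : Fin (N + 1) → Cube n, dimPotential (Module.finrank ℝ ↥(vanishingOn W ω)) =
        ∑ x : Cube n, ∑ ω : Fin N → Cube n,
          dimPotential (Module.finrank ℝ ↥(vanishingOn (W ⊓ vanishingAt x) ω)) := by
      rw [← Fintype.sum_prod_type', ← (Fin.consEquiv fun _ : Fin (N + 1) => Cube n).sum_comp]
      refine Finset.sum_congr rfl fun p _ => ?_
      rw [← hcons]
      rfl
    rw [e]
    calc _ ≤ ∑ x : Cube n, (2 ^ n * (1 - 1 / 2 ^ (d + 1))) ^ N *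
          dimPotential (Module.finrank ℝ ↥(W ⊓ vanishingAt x)) :=
          Finset.sum_le_sum fun x _ => ih (inf_le_left.trans hW)
      _ ≤ (2 ^ n * (1 - 1 / 2 ^ (d + 1))) ^ N *
          (2 ^ n * (1 - 1 / 2 ^ (d + 1)) * dimPotential (Module.finrank ℝ W)) := by
          rw [← Finset.mul_sum]
          exact mul_le_mul_of_nonneg_left (sum_dimPotential_vanishingAt_le hdn hW) (by positivity)
      _ = _ := by ring

open Classical in
/-- Few samples fail to determine the functions of degree at most `d`. -/
theorem card_vanishingOn_ne_bot_le {n d N : ℕ} (hdn : d ≤ n) :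
    ((Finset.univ.filter fun ω : Fin N → Cube n => vanishingOn (lowDegree n d) ω ≠ ⊥).card : ℝ) ≤
      (1 - 1 / 2 ^ (d + 1)) ^ N * 2 ^ ((lowDegreeSets n d).card - 1) * (2 ^ n) ^ N := by
  have hc : (0 : ℝ) ≤ 1 - 1 / 2 ^ (d + 1) :=
    sub_nonneg.2 ((div_le_one (by positivity)).2 (one_le_pow₀ (by norm_num)))
  calc _ = ∑ ω : Fin N → Cube n with vanishingOn (lowDegree n d) ω ≠ ⊥, (1 : ℝ) := by simp
    _ ≤ ∑ ω : Fin N → Cube n with vanishingOn (lowDegree n d) ω ≠ ⊥,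
        dimPotential (Module.finrank ℝ ↥(vanishingOn (lowDegree n d) ω)) := by
        refine Finset.sum_le_sum fun ω hω => ?_
        have h1 : Module.finrank ℝ ↥(vanishingOn (lowDegree n d) ω) ≠ 0 := fun h =>
          (Finset.mem_filter.1 hω).2 (Submodule.finrank_eq_zero.1 h)
        rw [dimPotential, if_neg h1]
        exact one_le_pow₀ (by norm_num)
    _ ≤ ∑ ω : Fin N → Cube n, dimPotential (Module.finrank ℝ ↥(vanishingOn (lowDegree n d) ω)) :=
        Finset.sum_le_sum_of_subset_of_nonneg (Finset.filter_subset _ _)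
          fun ω _ _ => dimPotential_nonneg _
    _ ≤ _ := sum_dimPotential_vanishingOn_le hdn le_rfl
    _ ≤ (2 ^ n * (1 - 1 / 2 ^ (d + 1))) ^ N * 2 ^ ((lowDegreeSets n d).card - 1) := by
        refine mul_le_mul_of_nonneg_left ?_ (by positivity)
        refine (dimPotential_mono (finrank_lowDegree_le n d)).trans ?_
        unfold dimPotential
        split_ifs
        · positivity
        · exact le_rfl
    _ = _ := by rw [mul_pow]; ring

open Classical in
/-- Some function of degree at most `d` that agrees with the labelled examples, if there is one. -/
noncomputable def interpolant {n N : ℕ} (d : ℕ) (D : Fin N → Cube n × ℝ) : Cube n → ℝ :=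
  if h : ∃ g ∈ lowDegree n d, ∀ j, g (D j).1 = (D j).2 then h.choose else 0

theorem interpolant_eq {n N d : ℕ} {f : Cube n → ℝ} (hf : f ∈ lowDegree n d)
    {ω : Fin N → Cube n} (hω : vanishingOn (lowDegree n d) ω = ⊥) :
    interpolant d (fun j => (ω j, f (ω j))) = f := by
  have h : ∃ g ∈ lowDegree n d, ∀ j, g (ω j, f (ω j)).1 = (ω j, f (ω j)).2 :=
    ⟨f, hf, fun j => rfl⟩
  rw [interpolant, dif_pos h]
  obtain ⟨hg, hgj⟩ := h.choose_spec
  have : h.choose - f ∈ vanishingOn (lowDegree n d) ω := by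
    refine ⟨Submodule.sub_mem _ hg hf, ?_⟩
    simp only [SetLike.mem_coe, Submodule.mem_iInf, mem_vanishingAt]
    intro j
    rw [Pi.sub_apply, hgj j, sub_self]
  rw [hω, Submodule.mem_bot] at this
  exact sub_eq_zero.1 this

theorem exists_interpolation_learner {ε δ : ℝ} (hε : ε ∈ Set.Ioo (0 : ℝ) 1)
    (hδ : δ ∈ Set.Ioo (0 : ℝ) 1) {n d N : ℕ} (hn : 2 ≤ n) (hd : 1 ≤ d) (hdn : d ≤ n)
    (hN : 4 * (d : ℝ) * (n : ℝ) ^ d / ε * Real.log ((n : ℝ) / δ) ≤ (N : ℝ)) :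
    ∃ A : Learner n N 0, ∀ f ∈ {f : Cube n → ℝ | (∀ x, f x ∈ Set.Icc (-1 : ℝ) 1) ∧
        DegreeAtMost d f},
      1 - δ ≤ (queryLaw n N 0).real {ω | l2NormSq (fun x => A.hypothesis f ω x - f x) < ε} := by
  classical
  obtain ⟨hε0, hε1⟩ := hε
  obtain ⟨hδ0, hδ1⟩ := hδ
  have hn2 : (2 : ℝ) ≤ n := by exact_mod_cast hn
  have hd1 : (1 : ℝ) ≤ d := by exact_mod_cast hd
  refine exists_learner_of_card_le (interpolant d) fun f hf => ?_
  have hsub : (Finset.univ.filter fun ω : Fin N → Cube n =>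
      ε ≤ l2NormSq fun x => interpolant d (fun j => (ω j, f (ω j))) x - f x) ⊆
      Finset.univ.filter fun ω : Fin N → Cube n => vanishingOn (lowDegree n d) ω ≠ ⊥ := by
    intro ω hω
    refine Finset.mem_filter.2 ⟨Finset.mem_univ _, fun hbot => ?_⟩
    have hω := (Finset.mem_filter.1 hω).2
    rw [interpolant_eq (mem_lowDegree_of_degreeAtMost hf.2) hbot] at hω
    simp [l2NormSq] at hω
    linarith
  refine (Nat.cast_le.2 (Finset.card_le_card hsub)).trans ((card_vanishingOn_ne_bot_le hdn).trans ?_)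
  refine mul_le_mul_of_nonneg_right ?_ (by positivity)
  set Mc := (lowDegreeSets n d).card with hMc
  have hM : (2 : ℝ) ^ (d + 1) * ((Mc - 1 : ℕ) : ℝ) ≤ 4 * d * n ^ d := by
    obtain ⟨e, rfl⟩ : ∃ e, d = e + 1 := ⟨d - 1, by omega⟩
    have h := two_pow_mul_card_lowDegreeSets_le hn e
    have h1 : 2 ^ e * (Mc - 1) ≤ (e + 1) * n ^ (e + 1) := by
      rw [← hMc] at h
      rw [Nat.mul_sub, mul_one]
      omega
    have h2 : (2 : ℝ) ^ e * ((Mc - 1 : ℕ) : ℝ) ≤ ((e : ℝ) + 1) * n ^ (e + 1) := by exact_mod_cast h1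
    push_cast
    calc (2 : ℝ) ^ (e + 1 + 1) * ((Mc - 1 : ℕ) : ℝ) = 4 * (2 ^ e * ((Mc - 1 : ℕ) : ℝ)) := by ring
      _ ≤ 4 * (((e : ℝ) + 1) * n ^ (e + 1)) := by linarith
      _ = _ := by ring
  have hM2 : (2 : ℝ) ^ (d + 1) ≤ 4 * d * n ^ d := by
    have : (2 : ℝ) ^ d ≤ n ^ d := pow_le_pow_left₀ (by norm_num) hn2 d
    have h3 : (0 : ℝ) < n ^ d := by positivity
    rw [pow_succ]
    nlinarith
  set Λ := Real.log ((n : ℝ) / δ) with hΛ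
  set l := Real.log (1 / δ) with hl
  have hl0 : 0 < l := Real.log_pos (by rwa [one_lt_div hδ0])
  have hΛl : Real.log 2 + l ≤ Λ := by
    rw [hΛ, hl, ← Real.log_mul two_ne_zero (by positivity)]
    refine Real.log_le_log (by positivity) ?_
    rw [mul_one_div]
    gcongr
  have hlog2 : 0 < Real.log 2 := Real.log_pos (by norm_num)
  have hNl : ((Mc - 1 : ℕ) : ℝ) * Real.log 2 + l ≤ N * (1 / 2 ^ (d + 1)) := by
    rw [mul_one_div, le_div_iff₀ (by positivity)]
    have hA : (0 : ℝ) ≤ 4 * d * n ^ d := by positivity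
    calc (((Mc - 1 : ℕ) : ℝ) * Real.log 2 + l) * 2 ^ (d + 1) =
          2 ^ (d + 1) * ((Mc - 1 : ℕ) : ℝ) * Real.log 2 + 2 ^ (d + 1) * l := by ring
      _ ≤ 4 * d * n ^ d * Real.log 2 + 4 * d * n ^ d * l := by gcongr
      _ = 4 * d * n ^ d * (Real.log 2 + l) := by ring
      _ ≤ 4 * d * n ^ d * Λ := by gcongr
      _ ≤ 4 * d * n ^ d / ε * Λ := by
          refine mul_le_mul_of_nonneg_right ?_ (by linarith)
          exact le_div_self hA hε0 hε1.le
      _ ≤ N := hN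
  have hc : (0 : ℝ) ≤ 1 - 1 / 2 ^ (d + 1) :=
    sub_nonneg.2 ((div_le_one (by positivity)).2 (one_le_pow₀ (by norm_num)))
  calc (1 - 1 / 2 ^ (d + 1) : ℝ) ^ N * 2 ^ (Mc - 1) ≤
        Real.exp (-(1 / 2 ^ (d + 1))) ^ N * Real.exp (Real.log 2) ^ (Mc - 1) := by
        rw [Real.exp_log two_pos]
        gcongr
        linarith [Real.add_one_le_exp (-(1 / 2 ^ (d + 1) : ℝ))]
    _ = Real.exp (((Mc - 1 : ℕ) : ℝ) * Real.log 2 - N * (1 / 2 ^ (d + 1))) := by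
        rw [← Real.exp_nat_mul, ← Real.exp_nat_mul, ← Real.exp_add]
        congr 1
        ring
    _ ≤ Real.exp (-l) := Real.exp_le_exp.2 (by linarith)
    _ = δ := by rw [hl, one_div, Real.log_inv, neg_neg, Real.exp_log hδ0]

/-! ### Dimension one: guessing with coins -/

/-- The grid of midpoints of `K` equal subintervals is `1/K`-dense in `[-1, 1]`. -/
theorem exists_grid_point_near {K : ℕ} (hK : 0 < K) {t : ℝ} (ht : t ∈ Set.Icc (-1 : ℝ) 1) :
    ∃ i : Fin K, |-1 + (2 * (i : ℝ) + 1) / K - t| ≤ 1 / K := by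
  have hK0 : (0 : ℝ) < K := by exact_mod_cast hK
  have key : ∀ i : ℕ, (i : ℝ) ≤ (t + 1) * K / 2 → (t + 1) * K / 2 ≤ i + 1 →
      |-1 + (2 * (i : ℝ) + 1) / K - t| ≤ 1 / K := fun i h1 h2 => by
    have e : -1 + (2 * (i : ℝ) + 1) / K - t = (2 * i + 1 - (t + 1) * K) / K := by
      field_simp; ring
    rw [e, abs_div, abs_of_pos hK0]
    gcongr
    exact abs_le.2 ⟨by linarith, by linarith⟩
  have h0 : 0 ≤ (t + 1) * K / 2 := by
    have : 0 ≤ t + 1 := by linarith [ht.1]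
    positivity
  by_cases hlt : ⌊(t + 1) * K / 2⌋₊ < K
  · exact ⟨⟨_, hlt⟩, key _ (Nat.floor_le h0) (Nat.lt_floor_add_one _).le⟩
  · have h1 : (K : ℝ) ≤ (t + 1) * K / 2 :=
      (Nat.cast_le.2 (not_lt.1 hlt)).trans (Nat.floor_le h0)
    refine ⟨⟨K - 1, by omega⟩, key _ ?_ ?_⟩
    · rw [Nat.cast_sub hK]; push_cast; linarith
    · rw [Nat.cast_sub hK]; push_cast; nlinarith [ht.2]

theorem cube_one_eq_or_eq_neg (x y : Cube 1) : y = x ∨ y = -x := by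
  rcases Int.units_eq_one_or (x 0) with h1 | h1 <;>
    rcases Int.units_eq_one_or (y 0) with h2 | h2
  · left; funext i; rw [Subsingleton.elim i 0, h1, h2]
  · right; funext i; rw [Subsingleton.elim i 0, Pi.neg_apply, h1, h2]
  · right; funext i; rw [Subsingleton.elim i 0, Pi.neg_apply, h1, h2, neg_neg]
  · left; funext i; rw [Subsingleton.elim i 0, h1, h2]

open Classical in
/-- In dimension one, a sample reveals the value at a point, and at an unseen point the value is
guessed on a grid of `2 ^ m` points, `2/ε < 2 ^ m ≤ 4/ε`, with `m` coins. -/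
theorem exists_learner_cube_one {ε δ : ℝ} (hε : ε ∈ Set.Ioo (0 : ℝ) 1)
    (hδ : δ ∈ Set.Ioo (0 : ℝ) 1) {N : ℕ} (hN : 4 / ε * Real.log (1 / δ) ≤ (N : ℝ)) :
    ∃ (m : ℕ) (A : Learner 1 N m), ∀ f : Cube 1 → ℝ, (∀ x, f x ∈ Set.Icc (-1 : ℝ) 1) →
      1 - δ ≤ (queryLaw 1 N m).real {ω | l2NormSq (fun x => A.hypothesis f ω x - f x) < ε} := by
  obtain ⟨hε0, hε1⟩ := hε
  obtain ⟨hδ0, hδ1⟩ := hδ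
  have hl0 : 0 < Real.log (1 / δ) := Real.log_pos (by rwa [one_lt_div hδ0])
  have hN0 : 0 < N := by
    have : (0 : ℝ) < N := lt_of_lt_of_le (by positivity) hN
    exact_mod_cast this
  obtain ⟨m, hm1, hm2⟩ := exists_nat_pow_near
    (show (1 : ℝ) ≤ 4 / ε by rw [one_le_div hε0]; linarith) one_lt_two
  have hcard : Fintype.card (Fin m → Bool) = 2 ^ m := by simp
  set e := Fintype.equivFinOfCardEq hcard with he
  set v : (Fin m → Bool) → ℝ := fun c => -1 + (2 * ((e c : ℕ) : ℝ) + 1) / (2 ^ m : ℕ) with hv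
  have hguess : ∀ t ∈ Set.Icc (-1 : ℝ) 1, ∃ c, (v c - t) ^ 2 < ε := fun t ht => by
    obtain ⟨i, hi⟩ := exists_grid_point_near (K := 2 ^ m) (by positivity) ht
    refine ⟨e.symm i, ?_⟩
    simp only [hv, Equiv.apply_symm_apply]
    have h1 : (1 : ℝ) / ((2 ^ m : ℕ) : ℝ) < ε / 2 := by
      push_cast
      rw [div_lt_div_iff₀ (by positivity) two_pos]
      rw [div_lt_iff₀ hε0, pow_succ] at hm2
      linarith
    have h2 := abs_le.1 (hi.trans h1.le)
    nlinarith
  set A : Learner 1 N m := fun c D x =>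
    if h : ∃ j, (D j).1 = x then (D h.choose).2 else v c with hA
  have hAseen : ∀ (f : Cube 1 → ℝ) (c) (ω : Fin N → Cube 1) (j), A.hypothesis f (c, ω) (ω j) =
      f (ω j) := fun f c ω j => by
    have h : ∃ i, ω i = ω j := ⟨j, rfl⟩
    simp only [Learner.hypothesis, hA]
    rw [dif_pos h, h.choose_spec]
  have hAunseen : ∀ (f : Cube 1 → ℝ) (c) (ω : Fin N → Cube 1) (x), (¬∃ j, ω j = x) →
      A.hypothesis f (c, ω) x = v c := fun f c ω x h => by
    simp only [Learner.hypothesis, hA]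
    rw [dif_neg h]
  refine ⟨m, A, fun f hf => one_sub_le_queryLaw_real _ ?_⟩
  choose c₀ hc₀ using fun x : Cube 1 => hguess (f (-x)) (hf (-x))
  set j₀ : Fin N := ⟨0, hN0⟩
  -- A sample can be bad only if it is constant and the coins miss the guess `c₀`.
  have hsub : (Finset.univ.filter fun ω : (Fin m → Bool) × (Fin N → Cube 1) =>
      ω ∉ {ω | l2NormSq (fun x => A.hypothesis f ω x - f x) < ε}) ⊆
      (Finset.univ : Finset (Cube 1)).biUnion fun x =>
        (Finset.univ.erase (c₀ x)).image fun c => (c, fun _ => x) := by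
    rintro ⟨c, ω⟩ hω
    have hω := (Finset.mem_filter.1 hω).2
    have hgood : (A.hypothesis f (c, ω) (-ω j₀) - f (-ω j₀)) ^ 2 < ε → False := fun h => by
      refine hω ?_
      rw [Set.mem_ofPred_eq]
      have hle : ∀ y : Cube 1, (A.hypothesis f (c, ω) y - f y) ^ 2 ≤
          if y = -ω j₀ then (A.hypothesis f (c, ω) (-ω j₀) - f (-ω j₀)) ^ 2 else 0 := fun y => by
        split_ifs with hy
        · rw [hy]
        · rcases cube_one_eq_or_eq_neg (ω j₀) y with h1 | h1
          · rw [h1, hAseen, sub_self, zero_pow two_ne_zero]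
          · exact absurd h1 hy
      have hs := Finset.sum_le_sum fun y (_ : y ∈ Finset.univ) => hle y
      rw [Finset.sum_ite_eq' Finset.univ, if_pos (Finset.mem_univ _)] at hs
      rw [l2NormSq]
      have h0 : 0 ≤ (A.hypothesis f (c, ω) (-ω j₀) - f (-ω j₀)) ^ 2 := sq_nonneg _
      norm_num
      linarith
    have hconst : ∀ j, ω j = ω j₀ := fun j => by
      rcases cube_one_eq_or_eq_neg (ω j₀) (ω j) with h | h
      · exact h
      · refine (hgood ?_).elim
        rw [← h, hAseen, sub_self, zero_pow two_ne_zero]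
        exact hε0
    refine Finset.mem_biUnion.2 ⟨ω j₀, Finset.mem_univ _, Finset.mem_image.2
      ⟨c, Finset.mem_erase.2 ⟨fun hc => hgood ?_, Finset.mem_univ _⟩,
        Prod.ext rfl (funext fun j => (hconst j).symm)⟩⟩
    by_cases h : ∃ j, ω j = -ω j₀
    · obtain ⟨j, hj⟩ := h
      rw [← hj, hAseen, sub_self, zero_pow two_ne_zero]
      exact hε0
    · rw [hAunseen f c ω _ h, hc]
      exact hc₀ _
  have hcount : (Finset.univ.filter fun ω : (Fin m → Bool) × (Fin N → Cube 1) =>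
      ω ∉ {ω | l2NormSq (fun x => A.hypothesis f ω x - f x) < ε}).card ≤ 2 * (2 ^ m - 1) := by
    refine (Finset.card_le_card hsub).trans (Finset.card_biUnion_le.trans ?_)
    calc _ ≤ ∑ _x : Cube 1, (2 ^ m - 1) := by
          refine Finset.sum_le_sum fun x _ => Finset.card_image_le.trans ?_
          rw [Finset.card_erase_of_mem (Finset.mem_univ _), Finset.card_univ, hcard]
      _ = _ := by rw [Finset.sum_const, Finset.card_univ, card_cube, smul_eq_mul, pow_one]
  refine (Nat.cast_le.2 hcount).trans ?_
  rw [Nat.cast_mul, Nat.cast_sub Nat.one_le_two_pow]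
  push_cast
  obtain ⟨M, rfl⟩ : ∃ M, N = M + 1 := ⟨N - 1, by omega⟩
  have hK : (2 : ℝ) ^ m - 1 ≤ 2 ^ m * Real.exp (-(ε / 4)) := by
    have h1 : (2 : ℝ) ^ m * (ε / 4) ≤ 1 := by
      rw [le_div_iff₀ hε0] at hm1
      linarith
    have h2 := Real.add_one_le_exp (-(ε / 4))
    have h3 : (0 : ℝ) < 2 ^ m := by positivity
    nlinarith
  have hhalf : (1 : ℝ) ≤ 2 * Real.exp (-(ε / 4)) := by
    have h2 := Real.add_one_le_exp (-(ε / 4))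
    linarith
  have hδe : Real.exp (-(ε / 4)) ^ (M + 1) ≤ δ := by
    have h1 : Real.log (1 / δ) ≤ ε / 4 * (M + 1 : ℕ) := by
      rw [div_mul_eq_mul_div, div_le_iff₀ hε0] at hN
      linarith
    rw [one_div, Real.log_inv] at h1
    rw [← Real.exp_nat_mul, ← Real.le_log_iff_exp_le hδ0]
    linarith
  calc 2 * ((2 : ℝ) ^ m - 1) ≤ 2 * (2 ^ m * Real.exp (-(ε / 4))) := by linarith
    _ = 2 * (2 ^ m * Real.exp (-(ε / 4))) * 1 := (mul_one _).symm
    _ ≤ 2 * (2 ^ m * Real.exp (-(ε / 4))) * (2 * Real.exp (-(ε / 4))) ^ M :=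
        mul_le_mul_of_nonneg_left (one_le_pow₀ hhalf) (by positivity)
    _ = Real.exp (-(ε / 4)) ^ (M + 1) * (2 ^ m * (2 ^ 1) ^ (M + 1)) := by
        rw [mul_pow]; ring
    _ ≤ _ := mul_le_mul_of_nonneg_right hδe (by positivity)

/-! ### The learning theorem -/

theorem theorem1 :
    ∃ C : ℝ, 0 < C ∧
      ∀ (ε δ : ℝ), ε ∈ Set.Ioo (0 : ℝ) 1 → δ ∈ Set.Ioo (0 : ℝ) 1 →
      ∀ (n d N : ℕ), 1 ≤ d → d ≤ n →
        min (Real.exp (C * (d : ℝ) ^ (3 / 2 : ℝ) * √(Real.log (max (d : ℝ) 2))) / ε ^ (d + 1))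
            (4 * (d : ℝ) * (n : ℝ) ^ d / ε) * Real.log ((n : ℝ) / δ) ≤ (N : ℝ) →
        ∃ (m : ℕ) (A : Learner n N m), (2 ≤ n → m = 0) ∧
          ∀ f : Cube n → ℝ, (∀ x, f x ∈ Set.Icc (-1 : ℝ) 1) → DegreeAtMost d f →
            1 - δ ≤ (queryLaw n N m).real
              {ω | l2NormSq (fun x => A.hypothesis f ω x - f x) < ε} := by
  refine ⟨300, by norm_num, fun ε δ hε hδ n d N hd hdn hN => ?_⟩
  rcases Nat.lt_or_ge n 2 with hn | hn
  · obtain rfl : n = 1 := by omega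
    obtain rfl : d = 1 := by omega
    have hε0 := hε.1
    have hmin : 4 / ε ≤ min (Real.exp (300 * ((1 : ℕ) : ℝ) ^ (3 / 2 : ℝ) *
        √(Real.log (max ((1 : ℕ) : ℝ) 2))) / ε ^ (1 + 1))
        (4 * ((1 : ℕ) : ℝ) * ((1 : ℕ) : ℝ) ^ 1 / ε) := by
      refine le_min ?_ (by simp)
      rw [Nat.cast_one, Real.one_rpow, max_eq_right one_le_two, mul_one]
      have h1 : 1 / 2 ≤ √(Real.log 2) :=
        Real.le_sqrt_of_sq_le (by linarith [Real.log_two_gt_d9])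
      have h2 := Real.add_one_le_exp (300 * √(Real.log 2))
      rw [div_le_div_iff₀ hε0 (by positivity)]
      have h3 : ε ^ (1 + 1) ≤ ε := by
        rw [pow_succ, pow_one]
        exact mul_le_of_le_one_left hε0.le hε.2.le
      nlinarith
    have hlog : 0 < Real.log (1 / δ) := Real.log_pos (by rw [one_lt_div hδ.1]; exact hδ.2)
    rw [Nat.cast_one] at hN hmin
    obtain ⟨m, A, hA⟩ := exists_learner_cube_one hε hδ
      ((mul_le_mul_of_nonneg_right hmin hlog.le).trans hN)
    exact ⟨m, A, fun h => absurd h (by norm_num), fun f hf _ => hA f hf⟩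
  · suffices h : ∃ A : Learner n N 0, ∀ f ∈ {f : Cube n → ℝ | (∀ x, f x ∈ Set.Icc (-1 : ℝ) 1) ∧
        DegreeAtMost d f},
        1 - δ ≤ (queryLaw n N 0).real {ω | l2NormSq (fun x => A.hypothesis f ω x - f x) < ε} by
      obtain ⟨A, hA⟩ := h
      exact ⟨0, A, fun _ => rfl, fun f hf hfd => hA f ⟨hf, hfd⟩⟩
    rcases min_choice (Real.exp (300 * (d : ℝ) ^ (3 / 2 : ℝ) *
      √(Real.log (max (d : ℝ) 2))) / ε ^ (d + 1)) (4 * (d : ℝ) * (n : ℝ) ^ d / ε) with h | h <;>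
      rw [h] at hN
    · exact exists_threshold_learner hε hδ hn hd hdn hN
    · exact exists_interpolation_learner hε hδ hn hd hdn hN
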